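/- **Setting.** Let $1\le N\le 3$, let $\Omega\subset\mathbb R^N$ be a bounded open set, and let $\mathbb H=(H_0^1(\Omega))^d$ with its product norm. Let $\lambda_1(\Omega)$ be the first Dirichlet eigenvalue of $-\Delta$ in $\Omega$, and let $|\cdot|_p$ be the norm of $L^p(\Omega)$. Fix integers $0=a_0<a_1<\dots<a_m=d$ and put $I_h=\{i: a_{h-1}<i\le a_h\}$ for $h=1,\dots,m$. Let $\mathcal K_1$ be the set of pairs $(i,j)$ with $i\ne j$ in the same group $I_h$, and $\mathcal K_2$ the set of pairs $(i,j)\in I_h\times I_k$ with $h\neq k$. For $V=(V_i)$ and $B=(\beta_{ij})$ with entries in $L^\infty(\Omega)$ and $\mathbf u\in\mathbb H$ let $\|u_i\|_{V_i}^2=\int_\Omega(|\nabla u_i|^2+V_iu_i^2)$ and $$J_{V,B}(\mathbf u)=\frac12\sum_{i=1}^d\|u_i\|_{V_i}^2-\frac14\sum_{i,j=1}^d\int_\Omega\beta_{ij}u_i^2u_j^2 .$$ For a functional $J$ on $\mathbb H$ let $$\mathcal N(V,J)=\Big\{\mathbf u\in\mathbb H:\ \sum_{i\in I_h}\|u_i\|_{V_i}^2\ne0\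 \text{ and }\ \sum_{i\in I_h}\partial_iJ(\mathbf u)u_i=0\ \text{ for every } h=1,\dots,m\Big\},$$ and $\mathcal N_{V,B}=\mathcal N(V,J_{V,B})$. Call $(V,B)$ admissible if $\beta_{ij}=\beta_{ji}$ for all $i,j$; for every $i$ there is a constant $l_i>-\lambda_1(\Omega)$ with $V_i\ge l_i$ a.e.; for every $i$ there is a constant $\mu_i>0$ with $\beta_{ii}\ge\mu_i$ a.e.; and $\beta_{ij}\ge0$ a.e. for every $(i,j)\in\mathcal K_1$. Let $(V^\infty,B^\infty)$ be admissible, and set $$J_\infty(\mathbf u)=\frac12\sum_{i=1}^d\|u_i\|_{V_i^\infty}^2-\frac14\sum_{h=1}^m\sum_{(i,j)\in I_h^2}\int_\Omega\beta_{ij}^\infty u_i^2u_j^2,\qquad \mathcal N_\infty=\mathcal N(V^\infty,J_\infty).$$ **Theorem.** There are constants $\overline\gamma,\underline\gamma,\bar M>0$, depending only on $\Omega$, the decomposition $(a_h)$ and $(V^\infty,B^\infty)$, with the following property. Let $(V^n,B^n)_{n\in\mathbb N}$ be admissible with $\beta^n_{ij}\le0$ a.e. for every $n$ and every $(i,j)\in\mathcal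 K_2$. Suppose that, in $L^\infty(\Omega)$ as $n\to\infty$, $V_i^n\to V_i^\infty$ and $\beta^n_{ii}\to\beta^\infty_{ii}$ for every $i$, $\beta_{ij}^n\to\beta_{ij}^\infty$ for every $(i,j)\in\mathcal K_1$, and $\beta^n_{ij}\to-\infty$ for every $(i,j)\in\mathcal K_2$ (that is, for every $C\in\mathbb R$ one has $\beta_{ij}^n\le C$ a.e. in $\Omega$ for all large $n$). For every $n$ let $\mathbf u^n$ be a minimizer of $J_{V^n,B^n}$ on $\mathcal N_{V^n,B^n}$. Then: 1. for all large $n$, $$\sum_{i=1}^d\int_\Omega|\nabla u_i^n|^2\le\overline\gamma,\qquad \sum_{i\in I_h}|u_i^n|_4^2\ge\underline\gamma\ \ (h=1,\dots,m),\qquad \sum_{i,j=1}^d\int_\Omega(\beta_{ij}^n)^-(u_i^nu_j^n)^2\le\bar M;$$ 2. a subsequence of $(\mathbf u^n)$ converges strongly in $\mathbb H$ to some $\mathbf u^\infty$ which achieves $$\inf\Big\{J_\infty(\mathbf u):\ \mathbf u\in\mathcal N_\infty\ \text{ and }\ \int_\Omega u_i^2u_j^2=0\ \text{ for every }(i,j)\in\mathcal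 K_2\Big\},$$ and the three estimates in 1. hold, with the same constants and for every $n$, with $\mathbf u^\infty$ in place of $\mathbf u^n$; 3. $\displaystyle\lim_{n\to\infty}\sum_{(i,j)\in\mathcal K_2}\int_\Omega(\beta_{ij}^n)^-(u_i^nu_j^n)^2=0.$ -/

import Mathlib

open MeasureTheory Filter Topology Set
open scoped ContDiff Gradient ENNReal BigOperators

noncomputable section

namespace Segregation

/-- `ℝ^N` with its Euclidean norm. -/
abbrev Eucl (N : ℕ) : Type := EuclideanSpace ℝ (Fin N)

/-! ### Function spaces -/

/-- Lebesgue measure on `Ω`. -/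
abbrev vol {N : ℕ} (Ω : Set (Eucl N)) : Measure (Eucl N) := volume.restrict Ω

/-- The space `L^∞(Ω)` with its norm. -/
abbrev LInf {N : ℕ} (Ω : Set (Eucl N)) : Type := Lp ℝ ∞ (vol Ω)

/-- The Hilbert space `L²(Ω) × L²(Ω; ℝ^N)` of pairs `(u, g)`, with squared norm `∫ u² + ∫ |g|²`. -/
abbrev L2Pair {N : ℕ} (Ω : Set (Eucl N)) : Type :=
  WithLp 2 (Lp ℝ 2 (vol Ω) × Lp (Eucl N) 2 (vol Ω))

/-- The pairs `(φ, ∇φ)`, where `φ` is a smooth function with compact support contained in `Ω`. -/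
def testPairs {N : ℕ} (Ω : Set (Eucl N)) : Submodule ℝ (L2Pair Ω) where
  carrier := {p | ∃ φ : Eucl N → ℝ, ContDiff ℝ ∞ φ ∧ HasCompactSupport φ ∧ tsupport φ ⊆ Ω ∧
    (p.fst : Eucl N → ℝ) =ᵐ[vol Ω] φ ∧ (p.snd : Eucl N → Eucl N) =ᵐ[vol Ω] ∇ φ}
  zero_mem' := by
    refine ⟨fun _ => 0, contDiff_const, HasCompactSupport.zero, ?_, ?_, ?_⟩
    · simp [tsupport]
    · exact Lp.coeFn_zero ℝ 2 (vol Ω)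
    · rw [gradient_fun_const']
      exact Lp.coeFn_zero (Eucl N) 2 (vol Ω)
  add_mem' := by
    rintro p q ⟨φ, hφ, cφ, sφ, p1, p2⟩ ⟨ψ, hψ, cψ, sψ, q1, q2⟩
    refine ⟨φ + ψ, hφ.add hψ, cφ.add cψ, (tsupport_add φ ψ).trans (union_subset sφ sψ), ?_, ?_⟩
    · exact (Lp.coeFn_add p.fst q.fst).trans (p1.add q1)
    · refine (Lp.coeFn_add p.snd q.snd).trans ((p2.add q2).trans (Eventually.of_forall ?_))
      intro x
      simp only [gradient, Pi.add_apply]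
      rw [fderiv_add ((hφ.differentiable (by simp)) x) ((hψ.differentiable (by simp)) x), map_add]
  smul_mem' := by
    rintro c p ⟨φ, hφ, cφ, sφ, p1, p2⟩
    refine ⟨c • φ, hφ.const_smul c, cφ.smul_left (f := fun _ => c),
      (tsupport_smul_subset_right (fun _ => c) φ).trans sφ, ?_, ?_⟩
    · exact (Lp.coeFn_smul c p.fst).trans (p1.const_smul c)
    · refine (Lp.coeFn_smul c p.snd).trans ((p2.const_smul c).trans (Eventually.of_forall ?_))
      intro x
      simp only [gradient, Pi.smul_apply]
      rw [fderiv_const_smul ((hφ.differentiable (by simp)) x)]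
      simp

/-- The Sobolev space `H₀¹(Ω)`: the closure of `C_c^∞(Ω)` in the `H¹` norm. A function `u` is
stored together with its (weak) gradient, as the pair `(u, ∇u)` in `L²(Ω) × L²(Ω; ℝ^N)`. -/
abbrev H01 {N : ℕ} (Ω : Set (Eucl N)) : Submodule ℝ (L2Pair Ω) :=
  (testPairs Ω).topologicalClosure

/-- The function underlying an element of `H₀¹(Ω)`. -/
def val {N : ℕ} {Ω : Set (Eucl N)} (u : H01 Ω) : Eucl N → ℝ := (u : L2Pair Ω).fst

/-- The weak gradient of an element of `H₀¹(Ω)`. -/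
def grad {N : ℕ} {Ω : Set (Eucl N)} (u : H01 Ω) : Eucl N → Eucl N := (u : L2Pair Ω).snd

/-- The Hilbert space `ℍ = H₀¹(Ω)^d` with its product norm. -/
abbrev HProd {N : ℕ} (Ω : Set (Eucl N)) (d : ℕ) : Type := PiLp 2 (fun _ : Fin d => H01 Ω)

/-- The first Dirichlet eigenvalue `λ₁(Ω)` of `-Δ`, as the infimum of the Rayleigh quotient. -/
def firstEigenvalue {N : ℕ} (Ω : Set (Eucl N)) : ℝ :=
  sInf {r : ℝ | ∃ u : H01 Ω, u ≠ 0 ∧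
    r = (∫ x, ‖grad u x‖ ^ 2 ∂(vol Ω)) / (∫ x, val u x ^ 2 ∂(vol Ω))}

/-! ### Decompositions into groups -/

/-- `0 = a_0 < a_1 < ⋯ < a_m = d`. -/
def IsDecomposition (m d : ℕ) (a : Fin (m + 1) → ℕ) : Prop :=
  a 0 = 0 ∧ StrictMono a ∧ a (Fin.last m) = d

/-- The groups of indices. Group number `h` (counted from `0`) consists of the indices `i`
(counted from `0`) with `a_h ≤ i < a_{h+1}`. -/
def group {m : ℕ} (d : ℕ) (a : Fin (m + 1) → ℕ) (h : Fin m) : Finset (Fin d) :=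
  Finset.univ.filter fun i => a h.castSucc ≤ (i : ℕ) ∧ (i : ℕ) < a h.succ

/-- Pairs of distinct indices of the same group. -/
def K1 {m : ℕ} (d : ℕ) (a : Fin (m + 1) → ℕ) : Set (Fin d × Fin d) :=
  {p | p.1 ≠ p.2 ∧ ∃ h, p.1 ∈ group d a h ∧ p.2 ∈ group d a h}

/-- Pairs of indices of different groups. -/
def K2 {m : ℕ} (d : ℕ) (a : Fin (m + 1) → ℕ) : Set (Fin d × Fin d) :=
  {p | ∃ h k, h ≠ k ∧ p.1 ∈ group d a h ∧ p.2 ∈ group d a k}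

/-! ### Energies and Nehari-type sets -/

section Energy

variable {N : ℕ} {Ω : Set (Eucl N)} {d m : ℕ}

/-- `‖u‖_V² = ∫ (|∇u|² + V u²)`. -/
def normSq (V : LInf Ω) (u : H01 Ω) : ℝ :=
  ∫ x, (‖grad u x‖ ^ 2 + V x * val u x ^ 2) ∂(vol Ω)

/-- `∫ β u² v²`. -/
def coupling (β : LInf Ω) (u v : H01 Ω) : ℝ :=
  ∫ x, β x * val u x ^ 2 * val v x ^ 2 ∂(vol Ω)

/-- The energy functional `J_{V,B}`. -/
def energy (V : Fin d → LInf Ω) (B : Fin d → Fin d → LInf Ω) (u : HProd Ω d) : ℝ :=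
  (1 / 2) * ∑ i, normSq (V i) (u i) - (1 / 4) * ∑ i, ∑ j, coupling (B i j) (u i) (u j)

/-- The limit functional `J_∞`, in which different groups do not interact. -/
def limitEnergy (a : Fin (m + 1) → ℕ) (V : Fin d → LInf Ω) (B : Fin d → Fin d → LInf Ω)
    (u : HProd Ω d) : ℝ :=
  (1 / 2) * ∑ i, normSq (V i) (u i) -
    (1 / 4) * ∑ h, ∑ i ∈ group d a h, ∑ j ∈ group d a h, coupling (B i j) (u i) (u j)

/-- The partial derivative `∂_i J(u) v`: the derivative at `u` of `J` in the direction of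
`(0, …, 0, v, 0, …, 0)` with `v` in position `i`. -/
def partialDeriv (J : HProd Ω d → ℝ) (u : HProd Ω d) (i : Fin d) (v : H01 Ω) : ℝ :=
  lineDeriv ℝ J u (PiLp.single 2 i v)

/-- The Nehari-type set of a functional `J`: those `u` with `∑_{i ∈ I_h} ‖u_i‖_{V_i}² ≠ 0` and
`∑_{i ∈ I_h} ∂_i J(u) u_i = 0` for every group `I_h`. -/
def nehari (a : Fin (m + 1) → ℕ) (V : Fin d → LInf Ω) (J : HProd Ω d → ℝ) :
    Set (HProd Ω d) :=
  {u | ∀ h : Fin m, (∑ i ∈ group d a h, normSq (V i) (u i)) ≠ 0 ∧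
    ∑ i ∈ group d a h, partialDeriv J u i (u i) = 0}

/-- The standing assumptions on potentials and couplings: `B` is symmetric,
`V_i ≥ l_i > -λ₁(Ω)`, `β_ii ≥ μ_i > 0`, and `β_ij ≥ 0` inside each group. -/
def Admissible (a : Fin (m + 1) → ℕ) (V : Fin d → LInf Ω) (B : Fin d → Fin d → LInf Ω) : Prop :=
  (∀ i j, B i j = B j i) ∧
  (∀ i, ∃ l : ℝ, -firstEigenvalue Ω < l ∧ ∀ᵐ x ∂(vol Ω), l ≤ V i x) ∧
  (∀ i, ∃ μ : ℝ, 0 < μ ∧ ∀ᵐ x ∂(vol Ω), μ ≤ B i i x) ∧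
  (∀ i j, (i, j) ∈ K1 d a → ∀ᵐ x ∂(vol Ω), 0 ≤ B i j x)

/-- `∫ β⁻ (u v)²`, with `β⁻ = max(-β, 0)`. -/
def negCoupling (β : LInf Ω) (u v : H01 Ω) : ℝ :=
  ∫ x, max (-β x) 0 * (val u x * val v x) ^ 2 ∂(vol Ω)

/-- The energy of the competitive interaction between different groups. -/
def interGroup (a : Fin (m + 1) → ℕ) (B : Fin d → Fin d → LInf Ω) (u : HProd Ω d) : ℝ :=
  open Classical in
  ∑ p ∈ Finset.univ.filter (fun p : Fin d × Fin d => p ∈ K2 d a),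
    negCoupling (B p.1 p.2) (u p.1) (u p.2)

/-- The bounds `∑_i ∫ |∇u_i|² ≤ γU`, `∑_{i ∈ I_h} |u_i|_4² ≥ γL` for every group `I_h`, and
`∑_{i,j} ∫ β_ij⁻ (u_i u_j)² ≤ M`. -/
def Estimates (a : Fin (m + 1) → ℕ) (B : Fin d → Fin d → LInf Ω) (γU γL M : ℝ)
    (u : HProd Ω d) : Prop :=
  (∑ i, ∫ x, ‖grad (u i) x‖ ^ 2 ∂(vol Ω) ≤ γU) ∧
  (∀ h : Fin m, γL ≤ ∑ i ∈ group d a h, (eLpNorm (val (u i)) 4 (vol Ω)).toReal ^ 2) ∧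
  (∑ i, ∑ j, negCoupling (B i j) (u i) (u j) ≤ M)

/-- The admissible set of the limit problem: the Nehari-type set of `J_∞`, under the constraint
that components of different groups satisfy `∫ u_i² u_j² = 0`. -/
def limitSet (a : Fin (m + 1) → ℕ) (V : Fin d → LInf Ω) (B : Fin d → Fin d → LInf Ω) :
    Set (HProd Ω d) :=
  {u | u ∈ nehari a V (limitEnergy a V B) ∧
    ∀ i j, (i, j) ∈ K2 d a → ∫ x, val (u i) x ^ 2 * val (u j) x ^ 2 ∂(vol Ω) = 0}

end Energy

end Segregation

end

noncomputable section

namespace Segregation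

/-! On a Nehari-type set the quartic part of the energy equals the quadratic part, so the energy is
a quarter of the sum of the group norms q_h (`energy_eq_of_mem_nehari`). A segregated element feels
no coupling between groups: scaling each group by t_h with t_h² = q_h / D_h, where D_h is the
coupling inside the group, puts it on the Nehari-type set whatever those couplings are, with new
total norm Σ q_h² / D_h (`exists_scaled`). One fixed segregated competitor thus bounds the minimal
energies for all large n. As couplings between groups are nonpositive, q_h ≤ D_h on the Nehari-type
set; q_h is at least quadratic and D_h at most quartic in the L⁴ norms, so no group can become
small, and the interaction energy Σ D_h - Σ q_h stays bounded (`Admissible.bounds_of_mem_nehari`).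

Along an ultrafilter the minimizers converge weakly in ℍ, and strongly in L² and L⁴ by compactness
(`exists_toL4`). The limit is nonzero in every group, and it is segregated because the couplings
tend to -∞ under a bounded interaction energy. Let q_h and D_h now refer to the limit and let A_h be
the limit of the group norms of the minimizers. Then q_h ≤ A_h ≤ D_h, and comparison with the
rescaled limit gives Σ A_h ≤ Σ q_h² / D_h ≤ Σ q_h. All these are equalities
(`eq_of_sum_le_sum_sq_div`): A_h = q_h is strong convergence, D_h = q_h places the limit on the
limit Nehari-type set, and D_h = A_h makes the interaction energy vanish. Minimality is the same
comparison with other segregated elements. No Euler–Lagrange equation is used. -/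

/-! ### The Sobolev inequality in L⁶ -/

lemma norm_gradient_eq {N : ℕ} (φ : Eucl N → ℝ) (x : Eucl N) : ‖∇ φ x‖ = ‖fderiv ℝ φ x‖ := by
  simp [gradient]

lemma eLpNorm_gradient_eq {N : ℕ} (φ : Eucl N → ℝ) (p : ℝ≥0∞) (μ : Measure (Eucl N)) :
    eLpNorm (∇ φ) p μ = eLpNorm (fderiv ℝ φ) p μ :=
  eLpNorm_congr_norm_ae (.of_forall fun x => norm_gradient_eq φ x)

/-- In dimension one a test function is bounded by the `L¹` norm of its derivative. -/
lemma enorm_le_lintegral_fderiv {φ : Eucl 1 → ℝ} (hφ : ContDiff ℝ ∞ φ) (hc : HasCompactSupport φ)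
    (x : Eucl 1) : ‖φ x‖ₑ ≤ ∫⁻ y, ‖fderiv ℝ φ y‖ₑ := by
  let L : ℝ ≃ₗᵢ[ℝ] Eucl 1 := (OrthonormalBasis.singleton (Fin 1) ℝ).repr
  have hd : Differentiable ℝ φ := hφ.differentiable (by simp)
  have hψ : ContDiff ℝ 1 (φ ∘ L) :=
    (hφ.of_le (by simp)).comp L.toContinuousLinearEquiv.contDiff
  have hcψ : HasCompactSupport (φ ∘ L) := hc.comp_homeomorph L.toHomeomorph
  have h1 := hcψ.enorm_le_lintegral_Ici_deriv hψ (L.symm x)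
  have h2 : ∀ t, ‖deriv (φ ∘ L) t‖ₑ ≤ ‖fderiv ℝ φ (L t)‖ₑ := by
    intro t
    have h3 : HasDerivAt (φ ∘ L) (fderiv ℝ φ (L t) (L 1)) t := by
      have := (hd (L t)).hasFDerivAt.comp_hasDerivAt t
        (L.toContinuousLinearEquiv.toContinuousLinearMap.hasDerivAt (x := t))
      exact this
    rw [h3.deriv]
    have h4 := (fderiv ℝ φ (L t)).le_opNorm (L 1)
    rw [L.norm_map, norm_one, mul_one] at h4
    exact enorm_le_iff_norm_le.2 h4
  calc ‖φ x‖ₑ = ‖(φ ∘ L) (L.symm x)‖ₑ := by simp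
    _ ≤ ∫⁻ t in Iic (L.symm x), ‖deriv (φ ∘ L) t‖ₑ := h1
    _ ≤ ∫⁻ t, ‖deriv (φ ∘ L) t‖ₑ := setLIntegral_le_lintegral _ _
    _ ≤ ∫⁻ t, ‖fderiv ℝ φ (L t)‖ₑ := lintegral_mono h2
    _ = ∫⁻ y, ‖fderiv ℝ φ y‖ₑ :=
      L.measurePreserving.lintegral_comp_emb L.toHomeomorph.measurableEmbedding
        (fun y => ‖fderiv ℝ φ y‖ₑ)

/-- The exponent p depends on the dimension: p = 1 for N = 1, through the sup bound; p = 3/2 for N =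
2, where p = 2 would be the excluded borderline case p = N and 2/3 - 1/2 = 1/6; p = 2 for N = 3,
whose Sobolev conjugate is 6. In all cases p ≤ 2, so Hölder on the bounded set reduces to the L²
norm of the gradient. -/
lemma exists_eLpNorm_le_of_fderiv {N : ℕ} (hN : 1 ≤ N) (hN3 : N ≤ 3) {Ω : Set (Eucl N)}
    (hΩb : Bornology.IsBounded Ω) :
    ∃ (C : ℝ≥0∞) (p : ℝ≥0∞), C ≠ ⊤ ∧ 1 ≤ p ∧ p ≤ 2 ∧ ∀ φ : Eucl N → ℝ, ContDiff ℝ ∞ φ →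
      HasCompactSupport φ → tsupport φ ⊆ Ω →
        eLpNorm φ 6 (vol Ω) ≤ C * eLpNorm (fderiv ℝ φ) p volume := by
  have hΩ : volume Ω < ⊤ := hΩb.measure_lt_top
  obtain rfl | rfl | rfl : N = 1 ∨ N = 2 ∨ N = 3 := by omega
  · refine ⟨vol Ω univ ^ (6 : ℝ)⁻¹, 1, ?_, le_rfl, by norm_num, fun φ h1 h2 h3 => ?_⟩
    · refine (ENNReal.rpow_lt_top_of_nonneg (by norm_num) ?_).ne
      simpa using hΩ.ne
    · have : IsFiniteMeasure (vol Ω) := ⟨by simpa using hΩ⟩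
      have h4 := eLpNorm_le_eLpNorm_mul_rpow_measure_univ (μ := vol Ω) (f := φ)
        (p := 6) (q := ⊤) le_top h1.continuous.aestronglyMeasurable
      refine h4.trans ?_
      rw [mul_comm]
      have h5 : eLpNorm φ ⊤ (vol Ω) ≤ eLpNorm (fderiv ℝ φ) 1 volume := by
        rw [eLpNorm_exponent_top, eLpNorm_one_eq_lintegral_enorm]
        exact essSup_le_of_ae_le _ (.of_forall fun x => enorm_le_lintegral_fderiv h1 h2 x)
      simp only [ENNReal.toReal_ofNat, ENNReal.toReal_top, div_zero, sub_zero, one_div]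
      gcongr
  · refine ⟨_, (3 / 2 : NNReal), ?_, ?_, ?_, fun φ h1 h2 h3 =>
      (eLpNorm_mono_measure _ Measure.restrict_le_self).trans
      (eLpNorm_le_eLpNorm_fderiv_of_le (F := ℝ) (μ := volume) (u := φ) (s := Ω)
        (h1.of_le (by simp)) ((subset_tsupport φ).trans h3)
        (p := 3 / 2) (q := 6) ?_ ?_ ?_ hΩb)⟩
    · exact ENNReal.coe_ne_top
    · rw [ENNReal.one_le_coe_iff]; rw [← NNReal.coe_le_coe]; norm_num
    · norm_cast; rw [← NNReal.coe_le_coe]; norm_num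
    · rw [← NNReal.coe_le_coe]; norm_num
    · simp; rw [← NNReal.coe_lt_coe]; norm_num
    · simp; norm_num
  · refine ⟨_, (2 : NNReal), ?_, ?_, ?_, fun φ h1 h2 h3 =>
      (eLpNorm_mono_measure _ Measure.restrict_le_self).trans
      (eLpNorm_le_eLpNorm_fderiv_of_le (F := ℝ) (μ := volume) (u := φ) (s := Ω)
        (h1.of_le (by simp)) ((subset_tsupport φ).trans h3)
        (p := 2) (q := 6) ?_ ?_ ?_ hΩb)⟩
    · exact ENNReal.coe_ne_top
    · norm_num
    · norm_num
    · norm_num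
    · simp; norm_num
    · simp; norm_num

lemma eLpNorm_vol_eq_of_support_subset {N : ℕ} {Ω : Set (Eucl N)} {F : Type*}
    [NormedAddCommGroup F] {f : Eucl N → F} (hf : Function.support f ⊆ Ω) (p : ℝ≥0∞) :
    eLpNorm f p (vol Ω) = eLpNorm f p volume :=
  eLpNorm_restrict_eq_of_support_subset hf

/-- The Sobolev inequality on test functions. -/
lemma exists_sobolev_test {N : ℕ} (hN : 1 ≤ N) (hN3 : N ≤ 3) {Ω : Set (Eucl N)}
    (hΩb : Bornology.IsBounded Ω) :
    ∃ C : ℝ≥0∞, C ≠ ⊤ ∧ ∀ φ : Eucl N → ℝ, ContDiff ℝ ∞ φ → HasCompactSupport φ → tsupport φ ⊆ Ω →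
      eLpNorm φ 6 (vol Ω) ≤ C * eLpNorm (∇ φ) 2 (vol Ω) := by
  obtain ⟨C, p, hC, hp1, hp2, h⟩ := exists_eLpNorm_le_of_fderiv hN hN3 hΩb
  have hΩ : volume Ω < ⊤ := hΩb.measure_lt_top
  have : IsFiniteMeasure (vol Ω) := ⟨by simpa using hΩ⟩
  refine ⟨C * vol Ω univ ^ (1 / p.toReal - 1 / (2 : ℝ≥0∞).toReal), ?_, fun φ h1 h2 h3 => ?_⟩
  · refine ENNReal.mul_ne_top hC (ENNReal.rpow_lt_top_of_nonneg ?_ (measure_ne_top _ _)).ne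
    have hp : p ≠ ⊤ := ne_top_of_le_ne_top (by simp) hp2
    have : p.toReal ≤ (2 : ℝ≥0∞).toReal := ENNReal.toReal_mono (by simp) hp2
    have h0 : 0 < p.toReal := ENNReal.toReal_pos (by positivity) hp
    exact sub_nonneg.2 (one_div_le_one_div_of_le h0 this)
  · have hs : Function.support (fderiv ℝ φ) ⊆ Ω := (support_fderiv_subset ℝ).trans h3
    have h4 : eLpNorm (fderiv ℝ φ) p (vol Ω) = eLpNorm (fderiv ℝ φ) p volume :=
      eLpNorm_vol_eq_of_support_subset hs p
    have h5 := eLpNorm_le_eLpNorm_mul_rpow_measure_univ (μ := vol Ω) hp2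
      (h1.continuous_fderiv (by simp)).aestronglyMeasurable
    rw [eLpNorm_gradient_eq, mul_assoc, mul_comm (_ ^ _)]
    exact (h φ h1 h2 h3).trans (mul_le_mul_right (h4.symm.trans_le h5) C)

lemma val_aestronglyMeasurable {N : ℕ} {Ω : Set (Eucl N)} (u : H01 Ω) :
    AEStronglyMeasurable (val u) (vol Ω) := Lp.aestronglyMeasurable _

lemma memLp_val {N : ℕ} {Ω : Set (Eucl N)} (u : H01 Ω) : MemLp (val u) 2 (vol Ω) := Lp.memLp _

lemma memLp_grad {N : ℕ} {Ω : Set (Eucl N)} (u : H01 Ω) : MemLp (grad u) 2 (vol Ω) := Lp.memLp _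

/-- The Sobolev embedding `H₀¹ ⊆ L⁶` in dimension at most three. -/
theorem exists_sobolev {N : ℕ} (hN : 1 ≤ N) (hN3 : N ≤ 3) {Ω : Set (Eucl N)}
    (hΩb : Bornology.IsBounded Ω) :
    ∃ C : ℝ≥0∞, C ≠ ⊤ ∧ ∀ u : H01 Ω,
      eLpNorm (val u) 6 (vol Ω) ≤ C * eLpNorm (grad u) 2 (vol Ω) := by
  obtain ⟨C, hC, h⟩ := exists_sobolev_test hN hN3 hΩb
  refine ⟨C, hC, fun u => ?_⟩
  have hu : (u : L2Pair Ω) ∈ closure (testPairs Ω : Set (L2Pair Ω)) := u.2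
  obtain ⟨p, hp, hlim⟩ := mem_closure_iff_seq_limit.1 hu
  have hfst : Tendsto (fun n => (p n).fst) atTop (𝓝 (u : L2Pair Ω).fst) :=
    ((WithLp.prod_continuous_ofLp 2 _ _).fst.tendsto _).comp hlim
  have hsnd : Tendsto (fun n => (p n).snd) atTop (𝓝 (u : L2Pair Ω).snd) :=
    ((WithLp.prod_continuous_ofLp 2 _ _).snd.tendsto _).comp hlim
  -- Approximation in H₀¹ gives no convergence in L⁶. An a.e. convergent subsequence suffices, since
  -- by Fatou the L⁶ norm is lower semicontinuous along it.
  obtain ⟨ns, hns, hae⟩ := (tendstoInMeasure_of_tendsto_Lp hfst).exists_seq_tendsto_ae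
  have h1 := Lp.eLpNorm_lim_le_liminf_eLpNorm (p := 6)
    (fun n => Lp.aestronglyMeasurable (p (ns n)).fst) _ hae
  have h2 : Tendsto (fun n => C * eLpNorm (p (ns n)).snd 2 (vol Ω)) atTop
      (𝓝 (C * eLpNorm (grad u) 2 (vol Ω))) := by
    refine ENNReal.Tendsto.const_mul ?_ (.inr hC)
    have := (hsnd.comp hns.tendsto_atTop).enorm
    simpa only [Function.comp_def, Lp.enorm_def, grad] using this
  refine h1.trans ?_
  rw [← h2.liminf_eq]
  refine liminf_le_liminf (.of_forall fun n => ?_)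
  obtain ⟨φ, a1, a2, a3, a4, a5⟩ := hp (ns n)
  rw [eLpNorm_congr_ae a4, eLpNorm_congr_ae a5]
  exact h φ a1 a2 a3

/-! ### Translation estimates and the Rellich inequality on a grid of cubes -/

lemma sq_lintegral_le_lintegral_sq {α : Type*} [MeasurableSpace α] {μ : Measure α}
    [IsProbabilityMeasure μ] {f : α → ℝ≥0∞} (hf : AEMeasurable f μ) :
    (∫⁻ x, f x ∂μ) ^ 2 ≤ ∫⁻ x, f x ^ 2 ∂μ := by
  have h := ENNReal.lintegral_mul_le_Lp_mul_Lq μ Real.HolderConjugate.two_two hf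
    (aemeasurable_const (b := (1 : ℝ≥0∞)))
  simp only [Pi.mul_apply, mul_one, ENNReal.rpow_ofNat, one_pow, lintegral_const, measure_univ,
    ENNReal.one_rpow] at h
  calc (∫⁻ x, f x ∂μ) ^ 2 ≤ ((∫⁻ x, f x ^ 2 ∂μ) ^ (1 / (2 : ℝ))) ^ 2 := by gcongr
    _ = ∫⁻ x, f x ^ 2 ∂μ := by
      rw [← ENNReal.rpow_natCast, ← ENNReal.rpow_mul]; norm_num

section Translation

variable {E : Type*} [NormedAddCommGroup E] [NormedSpace ℝ E] {φ : E → ℝ}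

/-- The fundamental theorem of calculus on the segment from x to x + h, then Jensen in the parameter
t. -/
lemma enorm_sub_sq_le (hφ : ContDiff ℝ 1 φ) (x h : E) :
    ‖φ (x + h) - φ x‖ₑ ^ 2 ≤
      ‖h‖ₑ ^ 2 * ∫⁻ t in Ioc (0 : ℝ) 1, ‖fderiv ℝ φ (x + t • h)‖ₑ ^ 2 := by
  have hc : Continuous fun t : ℝ => fderiv ℝ φ (x + t • h) :=
    (hφ.continuous_fderiv (by simp)).comp (by fun_prop)
  have hd : ∀ t ∈ uIcc (0 : ℝ) 1,
      HasDerivAt (fun t : ℝ => φ (x + t • h)) (fderiv ℝ φ (x + t • h) h) t := by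
    intro t _
    have h1 : HasDerivAt (fun t : ℝ => x + t • h) h t := by
      simpa using ((hasDerivAt_id t).smul_const h).const_add x
    exact ((hφ.differentiable (by simp)) _).hasFDerivAt.comp_hasDerivAt t h1
  have h2 := intervalIntegral.integral_eq_sub_of_hasDerivAt hd
    ((hc.clm_apply continuous_const).intervalIntegrable _ _)
  simp only [one_smul, zero_smul, add_zero] at h2
  have : IsProbabilityMeasure (volume.restrict (Ioc (0 : ℝ) 1)) := ⟨by simp⟩
  have hm : AEMeasurable (fun t : ℝ => ‖fderiv ℝ φ (x + t • h)‖ₑ)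
      (volume.restrict (Ioc (0 : ℝ) 1)) := hc.enorm.measurable.aemeasurable
  rw [← h2, intervalIntegral.integral_of_le zero_le_one]
  calc _ ≤ (∫⁻ t in Ioc (0 : ℝ) 1, ‖h‖ₑ * ‖fderiv ℝ φ (x + t • h)‖ₑ) ^ 2 := by
        gcongr
        refine (enorm_integral_le_lintegral_enorm _).trans (lintegral_mono fun t => ?_)
        rw [mul_comm]
        exact ContinuousLinearMap.le_opENorm _ _
    _ = ‖h‖ₑ ^ 2 * (∫⁻ t in Ioc (0 : ℝ) 1, ‖fderiv ℝ φ (x + t • h)‖ₑ) ^ 2 := by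
        rw [lintegral_const_mul'' _ hm, mul_pow]
    _ ≤ _ := by gcongr; exact sq_lintegral_le_lintegral_sq hm

variable [MeasurableSpace E] [BorelSpace E] [FiniteDimensional ℝ E] {μ : Measure E}
  [μ.IsAddHaarMeasure]

lemma lintegral_enorm_sub_sq_le (hφ : ContDiff ℝ 1 φ) (h : E) :
    ∫⁻ x, ‖φ (x + h) - φ x‖ₑ ^ 2 ∂μ ≤ ‖h‖ₑ ^ 2 * ∫⁻ x, ‖fderiv ℝ φ x‖ₑ ^ 2 ∂μ := by
  have hc : Continuous fun p : E × ℝ => ‖fderiv ℝ φ (p.1 + p.2 • h)‖ₑ ^ 2 :=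
    (ENNReal.continuous_pow 2).comp
      ((hφ.continuous_fderiv (by simp)).comp (by fun_prop)).enorm
  calc _ ≤ ∫⁻ x, ‖h‖ₑ ^ 2 * (∫⁻ t in Ioc (0 : ℝ) 1, ‖fderiv ℝ φ (x + t • h)‖ₑ ^ 2) ∂μ :=
        lintegral_mono fun x => enorm_sub_sq_le hφ x h
    _ = ‖h‖ₑ ^ 2 * ∫⁻ t in Ioc (0 : ℝ) 1, ∫⁻ x, ‖fderiv ℝ φ (x + t • h)‖ₑ ^ 2 ∂μ := by
        rw [lintegral_const_mul' _ _ (by finiteness), lintegral_lintegral_swap]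
        exact hc.measurable.aemeasurable
    _ = _ := by
        congr 1
        have : ∀ t : ℝ, ∫⁻ x, ‖fderiv ℝ φ (x + t • h)‖ₑ ^ 2 ∂μ = ∫⁻ x, ‖fderiv ℝ φ x‖ₑ ^ 2 ∂μ :=
          fun t => lintegral_add_right_eq_self (fun x => ‖fderiv ℝ φ x‖ₑ ^ 2) (t • h)
        simp [this]

/-- The nonlocal Dirichlet energy at scale `R` is controlled by the Dirichlet energy. -/
lemma lintegral_ball_enorm_sub_sq_le (hφ : ContDiff ℝ 1 φ) {R : ℝ} :
    ∫⁻ x, ∫⁻ y in Metric.ball x R, ‖φ y - φ x‖ₑ ^ 2 ∂μ ∂μ ≤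
      μ (Metric.ball 0 R) * ENNReal.ofReal R ^ 2 * ∫⁻ x, ‖fderiv ℝ φ x‖ₑ ^ 2 ∂μ := by
  have h1 : ∀ x, ∫⁻ y in Metric.ball x R, ‖φ y - φ x‖ₑ ^ 2 ∂μ =
      ∫⁻ h in Metric.ball 0 R, ‖φ (x + h) - φ x‖ₑ ^ 2 ∂μ := by
    intro x
    rw [← lintegral_indicator measurableSet_ball, ← lintegral_indicator measurableSet_ball,
      ← lintegral_add_left_eq_self _ x]
    congr 1 with h
    simp only [indicator, Metric.mem_ball, dist_self_add_left, dist_zero_right]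
  have hc : Continuous fun p : E × E => ‖φ (p.1 + p.2) - φ p.1‖ₑ ^ 2 := by
    have := hφ.continuous
    exact (ENNReal.continuous_pow 2).comp (Continuous.enorm (by fun_prop))
  simp_rw [h1]
  rw [lintegral_lintegral_swap hc.measurable.aemeasurable]
  calc _ ≤ ∫⁻ h in Metric.ball 0 R, ENNReal.ofReal R ^ 2 * (∫⁻ x, ‖fderiv ℝ φ x‖ₑ ^ 2 ∂μ) ∂μ := by
        refine setLIntegral_mono measurable_const fun h hh => ?_
        refine (lintegral_enorm_sub_sq_le hφ h).trans ?_
        gcongr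
        rw [← ofReal_norm]
        exact ENNReal.ofReal_le_ofReal (mem_ball_zero_iff.1 hh).le
    _ = _ := by simp [mul_comm, mul_left_comm, mul_assoc]

end Translation

/-- The variance identity, obtained by expanding the square. It turns the deviation of f from its
mean on a cube into a double integral of differences, which the nonlocal Dirichlet energy controls.
-/
lemma measureReal_mul_integral_sq_sub {α : Type*} [MeasurableSpace α] {μ : Measure α}
    [IsFiniteMeasure μ] {f : α → ℝ} (h1 : Integrable f μ) (h2 : Integrable (fun x => f x ^ 2) μ) :
    ENNReal.ofReal (2 * (μ.real univ * ∫ x, f x ^ 2 ∂μ - (∫ x, f x ∂μ) ^ 2)) =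
      ∫⁻ x, ∫⁻ y, ‖f y - f x‖ₑ ^ 2 ∂μ ∂μ := by
  have i0 : ∀ a b c : ℝ, Integrable (fun y => a * f y ^ 2 + b * f y + c) μ := fun a b c =>
    ((h2.const_mul a).add (h1.const_mul b)).add (integrable_const c)
  have e0 : ∀ a b c : ℝ, ∫ y, (a * f y ^ 2 + b * f y + c) ∂μ =
      a * (∫ y, f y ^ 2 ∂μ) + b * (∫ y, f y ∂μ) + c * μ.real univ := fun a b c => by
    rw [integral_add (f := fun y => a * f y ^ 2 + b * f y)
      ((h2.const_mul a).add (h1.const_mul b)) (integrable_const c),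
      integral_add (h2.const_mul a) (h1.const_mul b), integral_const_mul, integral_const_mul,
      integral_const, smul_eq_mul, mul_comm c]
  have e : ∀ x y, (f y - f x) ^ 2 = 1 * f y ^ 2 + (-2 * f x) * f y + f x ^ 2 := fun x y => by ring
  have i1 : ∀ x, Integrable (fun y => (f y - f x) ^ 2) μ := fun x => by
    simp_rw [e]; exact i0 _ _ _
  have e1 : ∀ x, ∫ y, (f y - f x) ^ 2 ∂μ =
      μ.real univ * f x ^ 2 + (-2 * ∫ y, f y ∂μ) * f x + ∫ y, f y ^ 2 ∂μ := fun x => by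
    simp_rw [e]; rw [e0]; ring
  have e2 : ∀ x, ∫⁻ y, ‖f y - f x‖ₑ ^ 2 ∂μ = ENNReal.ofReal (∫ y, (f y - f x) ^ 2 ∂μ) := fun x => by
    rw [ofReal_integral_eq_lintegral_ofReal (i1 x) (.of_forall fun y => sq_nonneg _)]
    congr 1 with y
    rw [← ofReal_norm, ← ENNReal.ofReal_pow (norm_nonneg _), Real.norm_eq_abs, sq_abs]
  simp_rw [e2]
  rw [← ofReal_integral_eq_lintegral_ofReal]
  · simp_rw [e1]
    rw [e0]
    congr 1
    ring
  · simp_rw [e1]; exact i0 _ _ _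
  · exact .of_forall fun x => integral_nonneg fun y => sq_nonneg _

/-- The half-open cube of side `ε` with index `k` in the grid. -/
def cube {N : ℕ} (ε : ℝ) (k : Fin N → ℤ) : Set (Eucl N) := {x | ∀ i, ⌊x i / ε⌋ = k i}

lemma measurableSet_cube {N : ℕ} (ε : ℝ) (k : Fin N → ℤ) : MeasurableSet (cube ε k) := by
  simp only [cube, Set.ofPred_forall]
  refine MeasurableSet.iInter fun i => ?_
  have h : Measurable fun x : Eucl N => ⌊x i / ε⌋ := by fun_prop
  exact h (measurableSet_singleton (k i))

lemma volume_cube {N : ℕ} {ε : ℝ} (hε : 0 < ε) (k : Fin N → ℤ) :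
    volume (cube ε k) = ENNReal.ofReal (ε ^ N) := by
  have h : cube ε k = (WithLp.ofLp : Eucl N → Fin N → ℝ) ⁻¹'
      (univ.pi fun i => Ico (ε * k i) (ε * (k i + 1))) := by
    ext x
    simp only [cube, Set.mem_ofPred_eq, mem_preimage, Set.mem_pi, mem_univ, true_imp_iff, mem_Ico,
      Int.floor_eq_iff, le_div_iff₀ hε, div_lt_iff₀ hε, mul_comm ε]
  rw [h, (PiLp.volume_preserving_ofLp (Fin N)).measure_preimage
    (MeasurableSet.univ_pi fun i => measurableSet_Ico).nullMeasurableSet, Real.volume_pi_Ico]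
  simp [mul_add, ENNReal.ofReal_pow hε.le]

/-- The diameter of the cube is at most √N ε, and (N + 1) ε is a larger radius without square roots.
-/
lemma cube_subset_ball {N : ℕ} {ε : ℝ} (hε : 0 < ε) (k : Fin N → ℤ) {x : Eucl N}
    (hx : x ∈ cube ε k) : cube ε k ⊆ Metric.ball x ((N + 1) * ε) := by
  intro y hy
  have h : ∀ i, |(y - x) i| ≤ ε := by
    intro i
    have h1 := Int.abs_sub_lt_one_of_floor_eq_floor ((hy i).trans (hx i).symm)
    rw [← sub_div, abs_div, abs_of_pos hε, div_lt_one hε] at h1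
    exact h1.le
  have h2 : ‖y - x‖ ^ 2 ≤ N * ε ^ 2 := by
    rw [EuclideanSpace.norm_sq_eq]
    calc _ ≤ ∑ _i : Fin N, ε ^ 2 := Finset.sum_le_sum fun i _ => by
          rw [Real.norm_eq_abs]; exact pow_le_pow_left₀ (abs_nonneg _) (h i) 2
      _ = _ := by simp
  rw [Metric.mem_ball, dist_eq_norm]
  have hN : (0 : ℝ) ≤ N := N.cast_nonneg
  refine lt_of_pow_lt_pow_left₀ 2 (by positivity) (h2.trans_lt ?_)
  have : 0 < ε ^ 2 := by positivity
  nlinarith [mul_nonneg (sq_nonneg (N : ℝ)) this.le, mul_nonneg hN this.le]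

lemma finite_cubes {N : ℕ} {ε : ℝ} (hε : 0 < ε) {Ω : Set (Eucl N)} (hΩ : Bornology.IsBounded Ω) :
    ∃ s : Finset (Fin N → ℤ), Ω ⊆ ⋃ k ∈ s, cube ε k := by
  obtain ⟨R, hR⟩ := hΩ.exists_norm_le
  refine ⟨Fintype.piFinset fun _ => Finset.Icc ⌊-R / ε⌋ ⌊R / ε⌋, fun x hx => ?_⟩
  simp only [mem_iUnion, exists_prop]
  refine ⟨fun i => ⌊x i / ε⌋, ?_, fun i => rfl⟩
  have h : ∀ i, |x i| ≤ R := fun i => (PiLp.norm_apply_le x i).trans (hR x hx)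
  simp only [Fintype.mem_piFinset, Finset.mem_Icc]
  exact fun i => ⟨Int.floor_mono (by gcongr; exact (abs_le.1 (h i)).1),
    Int.floor_mono (by gcongr; exact (abs_le.1 (h i)).2)⟩

lemma disjoint_cube {N : ℕ} {ε : ℝ} {k l : Fin N → ℤ} (h : k ≠ l) :
    Disjoint (cube ε k) (cube ε l) :=
  Set.disjoint_left.2 fun _ hx hy => h (funext fun i => (hx i).symm.trans (hy i))

lemma norm_sq_Lp_two {α F : Type*} [MeasurableSpace α] {μ : Measure α} [NormedAddCommGroup F]
    [InnerProductSpace ℝ F] (f : Lp F 2 μ) : ‖f‖ ^ 2 = ∫ x, ‖f x‖ ^ 2 ∂μ := by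
  rw [← real_inner_self_eq_norm_sq, L2.inner_def]
  simp

lemma integrable_sq_of_hasCompactSupport {N : ℕ} {f : Eucl N → ℝ} (hf : Continuous f)
    (hc : HasCompactSupport f) : Integrable (fun x => f x ^ 2) := by
  have h : HasCompactSupport (fun x => f x ^ 2) :=
    hc.mono fun x hx => by
      rw [Function.mem_support] at hx ⊢
      exact fun h0 => hx (by rw [h0]; norm_num)
  have h' : Continuous fun x => f x ^ 2 := by fun_prop
  exact h'.integrable_of_hasCompactSupport h

/-- The quantitative Rellich inequality on test functions, at scale `ε`. -/
lemma integral_sq_le_of_cubes {N : ℕ} {Ω : Set (Eucl N)} {ε : ℝ} (hε : 0 < ε)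
    {s : Finset (Fin N → ℤ)} (hs : Ω ⊆ ⋃ k ∈ s, cube ε k) {φ : Eucl N → ℝ} (hφ : ContDiff ℝ ∞ φ)
    (hc : HasCompactSupport φ) (ht : tsupport φ ⊆ Ω) :
    2 * ε ^ N * ∫ x in Ω, φ x ^ 2 ≤
      2 * (∑ k ∈ s, (∫ x in cube ε k, φ x ∂(vol Ω)) ^ 2) +
        volume.real (Metric.ball (0 : Eucl N) 1) * ((N + 1) * ε) ^ (N + 2) *
          ∫ x in Ω, ‖∇ φ x‖ ^ 2 := by
  have hφ1 : ContDiff ℝ 1 φ := hφ.of_le (by simp)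
  have hR : 0 < (N + 1) * ε := by positivity
  have i1 : Integrable φ := hφ.continuous.integrable_of_hasCompactSupport hc
  have i2 : Integrable (fun x => φ x ^ 2) := integrable_sq_of_hasCompactSupport hφ.continuous hc
  have i3 : Integrable (fun x => ‖∇ φ x‖ ^ 2) := by
    have h1 : Continuous fun x => ‖fderiv ℝ φ x‖ := (hφ.continuous_fderiv (by simp)).norm
    have h2 : HasCompactSupport fun x => ‖fderiv ℝ φ x‖ := (hc.fderiv ℝ).norm
    simp_rw [norm_gradient_eq]
    exact integrable_sq_of_hasCompactSupport h1 h2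
  have z : ∀ x, x ∉ Ω → φ x = 0 := fun x hx => image_eq_zero_of_notMem_tsupport fun h => hx (ht h)
  -- Cubes that cross the boundary are kept whole: φ extended by zero is smooth, so its integrals
  -- over the full cube and over the part in Ω agree.
  have hcube : ∀ k, ∫ x in cube ε k, φ x ∂(vol Ω) = ∫ x in cube ε k, φ x := by
    intro k
    rw [vol, Measure.restrict_restrict (measurableSet_cube ε k)]
    refine (setIntegral_eq_of_subset_of_forall_sdiff_eq_zero (measurableSet_cube ε k)
      inter_subset_left fun x hx => z x fun h => hx.2 ⟨hx.1, h⟩).symm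
  have hgrad : ∫⁻ x, ‖fderiv ℝ φ x‖ₑ ^ 2 = ENNReal.ofReal (∫ x in Ω, ‖∇ φ x‖ ^ 2) := by
    rw [setIntegral_eq_integral_of_forall_compl_eq_zero,
      ofReal_integral_eq_lintegral_ofReal i3 (.of_forall fun x => by positivity)]
    · congr 1 with x
      rw [norm_gradient_eq, ← ofReal_norm, ENNReal.ofReal_pow (norm_nonneg _)]
    · intro x hx
      have : fderiv ℝ φ x = 0 := by
        by_contra h
        exact hx (ht (support_fderiv_subset ℝ h))
      simp [norm_gradient_eq, this]
  have hvol : ∀ k, (volume.restrict (cube (N := N) ε k)).real univ = ε ^ N := fun k => by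
    rw [measureReal_restrict_apply_univ, measureReal_def, volume_cube hε,
      ENNReal.toReal_ofReal (by positivity)]
  have hfin : ∀ k, IsFiniteMeasure (volume.restrict (cube (N := N) ε k)) := fun k =>
    ⟨by rw [Measure.restrict_apply_univ, volume_cube hε]; exact ENNReal.ofReal_lt_top⟩
  have hball : volume (Metric.ball (0 : Eucl N) ((N + 1) * ε)) *
      ENNReal.ofReal ((N + 1) * ε) ^ 2 * (∫⁻ x, ‖fderiv ℝ φ x‖ₑ ^ 2) =
      ENNReal.ofReal (volume.real (Metric.ball (0 : Eucl N) 1) * ((N + 1) * ε) ^ (N + 2) *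
          ∫ x in Ω, ‖∇ φ x‖ ^ 2) := by
    have h1 : volume (Metric.ball (0 : Eucl N) 1) ≠ ⊤ := measure_ball_lt_top.ne
    generalize (N + 1) * ε = r at hR
    rw [hgrad, Measure.addHaar_ball_of_pos _ _ hR, measureReal_def, ENNReal.ofReal_mul (by positivity),
      ENNReal.ofReal_mul (by positivity), ENNReal.ofReal_toReal h1, finrank_euclideanSpace_fin,
      ENNReal.ofReal_pow hR.le, ENNReal.ofReal_pow hR.le]
    ring
  -- On each cube the variance is a double integral over pairs at distance less than (N + 1) ε. The
  -- cubes are disjoint, so the sum is at most the nonlocal energy at that scale.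
  have hsum : ∑ k ∈ s, ENNReal.ofReal (2 * (ε ^ N * (∫ x in cube ε k, φ x ^ 2) -
      (∫ x in cube ε k, φ x) ^ 2)) ≤ ENNReal.ofReal (volume.real (Metric.ball (0 : Eucl N) 1) *
        ((N + 1) * ε) ^ (N + 2) * ∫ x in Ω, ‖∇ φ x‖ ^ 2) := by
    rw [← hball]
    refine le_trans ?_ (lintegral_ball_enorm_sub_sq_le hφ1)
    calc _ = ∑ k ∈ s, ∫⁻ x in cube ε k, ∫⁻ y in cube ε k, ‖φ y - φ x‖ₑ ^ 2 := by
          refine Finset.sum_congr rfl fun k _ => ?_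
          have := hfin k
          rw [← measureReal_mul_integral_sq_sub i1.restrict i2.restrict, hvol]
      _ ≤ ∑ k ∈ s, ∫⁻ x in cube ε k, ∫⁻ y in Metric.ball x ((N + 1) * ε), ‖φ y - φ x‖ₑ ^ 2 := by
          refine Finset.sum_le_sum fun k _ => ?_
          exact setLIntegral_mono' (measurableSet_cube ε k) fun x hx =>
            lintegral_mono_set (cube_subset_ball hε k hx)
      _ = ∫⁻ x in ⋃ k ∈ s, cube ε k, ∫⁻ y in Metric.ball x ((N + 1) * ε), ‖φ y - φ x‖ₑ ^ 2 :=
          (lintegral_biUnion_finset (fun k _ l _ h => disjoint_cube h)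
            (fun k _ => measurableSet_cube ε k) _).symm
      _ ≤ _ := setLIntegral_le_lintegral _ _
  have hreal : ∑ k ∈ s, 2 * (ε ^ N * (∫ x in cube ε k, φ x ^ 2) -
      (∫ x in cube ε k, φ x) ^ 2) ≤ volume.real (Metric.ball (0 : Eucl N) 1) *
        ((N + 1) * ε) ^ (N + 2) * ∫ x in Ω, ‖∇ φ x‖ ^ 2 := by
    have h := ENNReal.toReal_mono ENNReal.ofReal_ne_top hsum
    rw [ENNReal.toReal_sum (fun _ _ => ENNReal.ofReal_ne_top),
      ENNReal.toReal_ofReal (by positivity)] at h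
    refine le_trans (Finset.sum_le_sum fun k _ => ?_) h
    rw [ENNReal.toReal_ofReal']
    exact le_max_left _ _
  have hcov : ∫ x in Ω, φ x ^ 2 ≤ ∑ k ∈ s, ∫ x in cube ε k, φ x ^ 2 := by
    rw [← integral_biUnion_finset s (fun k _ => measurableSet_cube ε k)
      (fun k _ l _ h => disjoint_cube h) (fun k _ => i2.integrableOn)]
    exact setIntegral_mono_set i2.integrableOn (.of_forall fun x => sq_nonneg _)
      hs.eventuallyLE
  simp_rw [hcube]
  rw [← Finset.mul_sum, Finset.sum_sub_distrib, ← Finset.mul_sum] at hreal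
  have := mul_le_mul_of_nonneg_left hcov (by positivity : 0 ≤ ε ^ N)
  linarith

/-! ### Compactness of H₀¹ in L² and in L⁴ -/

/-- The function underlying an element of `H₀¹(Ω)`, as an element of `L²(Ω)`. -/
def toL2 {N : ℕ} (Ω : Set (Eucl N)) : H01 Ω →L[ℝ] Lp ℝ 2 (vol Ω) :=
  (WithLp.fstL 2 ℝ (Lp ℝ 2 (vol Ω)) (Lp (Eucl N) 2 (vol Ω))).comp (H01 Ω).subtypeL

/-- The weak gradient of an element of `H₀¹(Ω)`, as an element of `L²(Ω)`. -/
def gradL2 {N : ℕ} (Ω : Set (Eucl N)) : H01 Ω →L[ℝ] Lp (Eucl N) 2 (vol Ω) :=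
  (WithLp.sndL 2 ℝ (Lp ℝ 2 (vol Ω)) (Lp (Eucl N) 2 (vol Ω))).comp (H01 Ω).subtypeL

section Pair

variable {N : ℕ} {Ω : Set (Eucl N)}

lemma coe_toL2 (u : H01 Ω) : (toL2 Ω u : Eucl N → ℝ) = val u := rfl

lemma coe_gradL2 (u : H01 Ω) : (gradL2 Ω u : Eucl N → Eucl N) = grad u := rfl

lemma norm_sq_eq_add (u : H01 Ω) : ‖u‖ ^ 2 = ‖toL2 Ω u‖ ^ 2 + ‖gradL2 Ω u‖ ^ 2 :=
  WithLp.prod_norm_sq_eq_of_L2 (u : L2Pair Ω)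

lemma norm_sq_toL2 (u : H01 Ω) : ‖toL2 Ω u‖ ^ 2 = ∫ x, val u x ^ 2 ∂(vol Ω) := by
  rw [norm_sq_Lp_two]; simp [coe_toL2]

lemma norm_sq_gradL2 (u : H01 Ω) : ‖gradL2 Ω u‖ ^ 2 = ∫ x, ‖grad u x‖ ^ 2 ∂(vol Ω) :=
  norm_sq_Lp_two _

/-- A quantitative form of the Rellich theorem. -/
theorem exists_rellich (hΩb : Bornology.IsBounded Ω) {δ : ℝ} (hδ : 0 < δ) :
    ∃ (s : Finset (Fin N → ℤ)) (f : (Fin N → ℤ) → H01 Ω →L[ℝ] ℝ) (K : ℝ), ∀ u : H01 Ω,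
      ‖toL2 Ω u‖ ^ 2 ≤ δ * ‖u‖ ^ 2 + K * ∑ k ∈ s, f k u ^ 2 := by
  set v := volume.real (Metric.ball (0 : Eucl N) 1) with hv
  -- Dividing the cube inequality by 2 ε ^ N leaves a gradient term of order ε², so a fine grid
  -- makes its coefficient at most δ.
  obtain ⟨ε, hε, hε2⟩ : ∃ ε : ℝ, 0 < ε ∧ v * (N + 1) ^ (N + 2) * ε ^ 2 ≤ 2 * δ := by
    have h : Tendsto (fun ε : ℝ => v * (N + 1) ^ (N + 2) * ε ^ 2) (𝓝[>] 0) (𝓝 0) := by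
      have : Continuous fun ε : ℝ => v * (N + 1) ^ (N + 2) * ε ^ 2 := by fun_prop
      simpa using (this.tendsto 0).mono_left nhdsWithin_le_nhds
    obtain ⟨ε, h1, h2⟩ := ((h.eventually_lt_const (by positivity : 0 < 2 * δ)).and
      self_mem_nhdsWithin).exists
    exact ⟨ε, h2, h1.le⟩
  obtain ⟨s, hs⟩ := finite_cubes hε hΩb
  have hfin : IsFiniteMeasure (vol Ω) := ⟨by simpa using hΩb.measure_lt_top⟩
  let g : (Fin N → ℤ) → Lp ℝ 2 (vol Ω) →L[ℝ] ℝ := fun k => innerSL ℝ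
    (indicatorConstLp 2 (measurableSet_cube ε k) (measure_ne_top (vol Ω) _) (1 : ℝ))
  have hg : ∀ k p, g k p = ∫ x in cube ε k, p x ∂(vol Ω) := fun k p =>
    L2.inner_indicatorConstLp_one (measurableSet_cube ε k) (measure_ne_top (vol Ω) _) p
  refine ⟨s, fun k => (g k).comp (toL2 Ω), (ε ^ N)⁻¹, fun u => ?_⟩
  -- The inequality is a closed condition on pairs in L² × L², so it passes from test functions to
  -- their closure.
  have hclosed : IsClosed {p : L2Pair Ω | ‖p.fst‖ ^ 2 ≤ δ * ‖p‖ ^ 2 +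
      (ε ^ N)⁻¹ * ∑ k ∈ s, g k p.fst ^ 2} := by
    have : Continuous fun p : L2Pair Ω => p.fst := (WithLp.prod_continuous_ofLp 2 _ _).fst
    exact isClosed_le (by fun_prop) (by fun_prop)
  refine closure_minimal ?_ hclosed u.2
  rintro p ⟨φ, h1, h2, h3, h4, h5⟩
  have key := integral_sq_le_of_cubes hε hs h1 h2 h3
  have e1 : ‖p.fst‖ ^ 2 = ∫ x in Ω, φ x ^ 2 := by
    rw [norm_sq_Lp_two]
    refine integral_congr_ae ?_
    filter_upwards [h4] with x hx
    simp [hx]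
  have e2 : ‖p.snd‖ ^ 2 = ∫ x in Ω, ‖∇ φ x‖ ^ 2 := by
    rw [norm_sq_Lp_two]
    refine integral_congr_ae ?_
    filter_upwards [h5] with x hx
    simp [hx]
  have e3 : ∀ k, g k p.fst = ∫ x in cube ε k, φ x ∂(vol Ω) := fun k => by
    rw [hg]
    exact integral_congr_ae (ae_restrict_of_ae h4)
  simp_rw [← e3] at key
  rw [← e1, ← e2, mul_pow, ← hv] at key
  have hp : ‖p.snd‖ ^ 2 ≤ ‖p‖ ^ 2 := by
    rw [WithLp.prod_norm_sq_eq_of_L2 p]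
    linarith [sq_nonneg ‖p.fst‖]
  have hεN : 0 < ε ^ N := by positivity
  rw [Set.mem_ofPred_eq, ← mul_le_mul_iff_right₀ (by positivity : 0 < 2 * ε ^ N)]
  calc _ ≤ _ := key
    _ = 2 * (∑ k ∈ s, g k p.fst ^ 2) +
        ε ^ N * ((v * (N + 1) ^ (N + 2) * ε ^ 2) * ‖p.snd‖ ^ 2) := by ring
    _ ≤ 2 * (∑ k ∈ s, g k p.fst ^ 2) + ε ^ N * ((2 * δ) * ‖p‖ ^ 2) := by gcongr
    _ = _ := by field_simp; ring

/-- Weakly convergent bounded families in `H₀¹(Ω)` converge strongly in `L²(Ω)`. -/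
theorem tendsto_toL2_of_weak (hΩb : Bornology.IsBounded Ω) {ι : Type*}
    {l : Filter ι} {w : ι → H01 Ω} {u : H01 Ω} {R : ℝ} (hR : ∀ᶠ n in l, ‖w n‖ ≤ R)
    (hw : ∀ f : H01 Ω →L[ℝ] ℝ, Tendsto (fun n => f (w n)) l (𝓝 (f u))) :
    Tendsto (fun n => toL2 Ω (w n)) l (𝓝 (toL2 Ω u)) := by
  rw [tendsto_iff_norm_sub_tendsto_zero]
  have h0 : Tendsto (fun n => ‖toL2 Ω (w n - u)‖ ^ 2) l (𝓝 0) := by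
    refine Metric.tendsto_nhds.2 fun η hη => ?_
    set D := (|R| + ‖u‖) ^ 2 + 1
    have hD : 0 < D := by positivity
    obtain ⟨s, f, K, h⟩ := exists_rellich hΩb (div_pos hη (by positivity : 0 < 2 * D))
    have h1 : Tendsto (fun n => K * ∑ k ∈ s, f k (w n - u) ^ 2) l (𝓝 0) := by
      have : ∀ k, Tendsto (fun n => f k (w n - u)) l (𝓝 0) := fun k => by
        simpa [map_sub] using (hw (f k)).sub_const (f k u)
      simpa using (tendsto_finsetSum s fun k _ => (this k).pow 2).const_mul K
    filter_upwards [hR, h1.eventually_lt_const (by positivity : 0 < η / 2)] with n hn1 hn2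
    rw [Real.dist_0_eq_abs, abs_of_nonneg (by positivity)]
    refine (h _).trans_lt ?_
    have h3 : ‖w n - u‖ ^ 2 ≤ D := by
      have : ‖w n - u‖ ≤ |R| + ‖u‖ :=
        (norm_sub_le _ _).trans (by gcongr; exact hn1.trans (le_abs_self R))
      calc _ ≤ (|R| + ‖u‖) ^ 2 := by gcongr
        _ ≤ D := by simp [D]
    have h4 : η / (2 * D) * ‖w n - u‖ ^ 2 ≤ η / 2 := by
      calc _ ≤ η / (2 * D) * D := by gcongr
        _ = η / 2 := by field_simp
    linarith
  have := h0.sqrt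
  simpa [Real.sqrt_sq, map_sub] using this

end Pair

instance : Fact ((1 : ℝ≥0∞) ≤ 4) := ⟨by norm_num⟩

/-- Interpolation: Cauchy–Schwarz applied to |f|⁴ = |f| · |f|³. -/
lemma eLpNorm_four_pow_le {α : Type*} [MeasurableSpace α] {μ : Measure α} {f : α → ℝ}
    (hf : AEStronglyMeasurable f μ) :
    eLpNorm f 4 μ ^ 4 ≤ eLpNorm f 2 μ * eLpNorm f 6 μ ^ 3 := by
  have h := ENNReal.lintegral_mul_le_Lp_mul_Lq μ Real.HolderConjugate.two_two hf.enorm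
    (hf.enorm.pow_const 3)
  rw [eLpNorm_eq_lintegral_rpow_enorm_toReal (by norm_num) (by norm_num),
    eLpNorm_eq_lintegral_rpow_enorm_toReal (by norm_num) (by norm_num),
    eLpNorm_eq_lintegral_rpow_enorm_toReal (by norm_num) (by norm_num),
    ← ENNReal.rpow_natCast, ← ENNReal.rpow_natCast, ← ENNReal.rpow_mul, ← ENNReal.rpow_mul]
  simp only [Pi.mul_apply, ENNReal.rpow_ofNat, ENNReal.toReal_ofNat, ← pow_succ', ← pow_mul,
    Nat.cast_ofNat] at h ⊢
  norm_num at h ⊢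
  exact h

/-- The compact Sobolev embedding `H₀¹(Ω) ⊆ L⁴(Ω)`, in dimension at most three. -/
theorem exists_toL4 {N : ℕ} (hN : 1 ≤ N) (hN3 : N ≤ 3) {Ω : Set (Eucl N)}
    (hΩb : Bornology.IsBounded Ω) :
    ∃ T : H01 Ω →L[ℝ] Lp ℝ 4 (vol Ω), (∀ u, T u =ᵐ[vol Ω] val u) ∧
      ∀ (l : Ultrafilter ℕ) (w : ℕ → H01 Ω) (u : H01 Ω) (R : ℝ), (∀ᶠ n in l, ‖w n‖ ≤ R) →
        (∀ f : H01 Ω →L[ℝ] ℝ, Tendsto (fun n => f (w n)) l (𝓝 (f u))) →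
          Tendsto (fun n => T (w n)) l (𝓝 (T u)) := by
  obtain ⟨C, hC, h⟩ := exists_sobolev hN hN3 hΩb
  -- The factor in L² is what makes the embedding compact: it tends to zero along weakly null
  -- bounded families while the cubed factor stays bounded.
  have key : ∀ u : H01 Ω, eLpNorm (val u) 4 (vol Ω) ^ 4 ≤
      ENNReal.ofReal (‖toL2 Ω u‖ * (C.toReal * ‖u‖) ^ 3) := fun u => by
    have e1 : eLpNorm (val u) 2 (vol Ω) = ENNReal.ofReal ‖toL2 Ω u‖ := by
      rw [ofReal_norm, Lp.enorm_def, coe_toL2]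
    have e2 : eLpNorm (grad u) 2 (vol Ω) = ENNReal.ofReal ‖gradL2 Ω u‖ := by
      rw [ofReal_norm, Lp.enorm_def, coe_gradL2]
    have e3 : ‖gradL2 Ω u‖ ≤ ‖u‖ := by
      refine le_of_sq_le_sq ?_ (norm_nonneg _)
      rw [norm_sq_eq_add u]
      linarith [sq_nonneg ‖toL2 Ω u‖]
    calc _ ≤ eLpNorm (val u) 2 (vol Ω) * eLpNorm (val u) 6 (vol Ω) ^ 3 :=
          eLpNorm_four_pow_le (val_aestronglyMeasurable u)
      _ ≤ ENNReal.ofReal ‖toL2 Ω u‖ * (ENNReal.ofReal C.toReal * ENNReal.ofReal ‖u‖) ^ 3 := by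
          rw [e1]
          gcongr
          refine (h u).trans ?_
          rw [e2, ENNReal.ofReal_toReal hC]
          gcongr
      _ = _ := by
          rw [ENNReal.ofReal_mul (norm_nonneg _), ENNReal.ofReal_pow (by positivity),
            ENNReal.ofReal_mul (by positivity)]
  have hmem : ∀ u : H01 Ω, MemLp (val u) 4 (vol Ω) := fun u =>
    ⟨val_aestronglyMeasurable u, by
      by_contra h1
      have := key u
      rw [not_lt_top_iff.1 h1, ENNReal.top_pow (by norm_num)] at this
      exact ENNReal.ofReal_ne_top (top_unique this)⟩
  have hbound : ∀ u : H01 Ω, ‖(hmem u).toLp‖ ^ 4 ≤ ‖toL2 Ω u‖ * (C.toReal * ‖u‖) ^ 3 := fun u => by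
    rw [Lp.norm_toLp, ← ENNReal.toReal_pow]
    exact ENNReal.toReal_le_of_le_ofReal (by positivity) (key u)
  let T₀ : H01 Ω →ₗ[ℝ] Lp ℝ 4 (vol Ω) :=
    { toFun := fun u => (hmem u).toLp
      map_add' := fun u v => by
        rw [← MemLp.toLp_add]
        exact MemLp.toLp_congr _ _ (Lp.coeFn_add (toL2 Ω u) (toL2 Ω v))
      map_smul' := fun c u => by
        rw [RingHom.id_apply, ← MemLp.toLp_const_smul]
        exact MemLp.toLp_congr _ _ (Lp.coeFn_smul c (toL2 Ω u)) }
  have hT₀ : ∀ u, ‖T₀ u‖ ≤ (1 + C.toReal) * ‖u‖ := fun u => by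
    have e4 : ‖toL2 Ω u‖ ≤ ‖u‖ := by
      refine le_of_sq_le_sq ?_ (norm_nonneg _)
      rw [norm_sq_eq_add u]
      linarith [sq_nonneg ‖gradL2 Ω u‖]
    have hC0 : 0 ≤ C.toReal := ENNReal.toReal_nonneg
    refine le_of_pow_le_pow_left₀ (n := 4) (by norm_num) (by positivity) ?_
    calc ‖T₀ u‖ ^ 4 ≤ ‖toL2 Ω u‖ * (C.toReal * ‖u‖) ^ 3 := hbound u
      _ ≤ ((1 + C.toReal) * ‖u‖) * ((1 + C.toReal) * ‖u‖) ^ 3 := by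
        gcongr
        · nlinarith [norm_nonneg u]
        · linarith
      _ = _ := by ring
  let T := T₀.mkContinuous _ hT₀
  refine ⟨T, fun u => (hmem u).coeFn_toLp, fun l w u R hR hw => ?_⟩
  rw [tendsto_iff_norm_sub_tendsto_zero]
  have h2 : Tendsto (fun n => ‖toL2 Ω (w n - u)‖) l (𝓝 0) := by
    simpa only [map_sub] using
      tendsto_iff_norm_sub_tendsto_zero.1 (tendsto_toL2_of_weak hΩb hR hw)
  have h3 : Tendsto (fun n => ‖T (w n - u)‖ ^ 4) l (𝓝 0) := by
    refine squeeze_zero' (.of_forall fun n => by positivity) ?_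
      ((h2.mul_const ((C.toReal * (|R| + ‖u‖)) ^ 3)).mono_right (by rw [zero_mul]))
    filter_upwards [hR] with n hn
    refine (hbound _).trans ?_
    have : ‖w n - u‖ ≤ |R| + ‖u‖ :=
      (norm_sub_le _ _).trans (by gcongr; exact hn.trans (le_abs_self R))
    gcongr
  have h4 := h3.sqrt.sqrt
  have e : ∀ t : ℝ, 0 ≤ t → √√(t ^ 4) = t := fun t ht => by
    rw [show t ^ 4 = (t ^ 2) ^ 2 by ring, Real.sqrt_sq (by positivity), Real.sqrt_sq ht]
  simpa [e, map_sub] using h4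

/-! ### The quadratic and quartic forms and their continuity -/

instance : ENNReal.HolderTriple 4 4 2 := ⟨by
  rw [← ENNReal.toReal_eq_toReal_iff' (by simp) (by simp), ENNReal.toReal_add (by simp) (by simp)]
  norm_num⟩

section Forms

variable {N : ℕ} {Ω : Set (Eucl N)}

/-- The product `L⁴ × L⁴ → L²`. -/
def mulL4 (Ω : Set (Eucl N)) : Lp ℝ 4 (vol Ω) →L[ℝ] Lp ℝ 4 (vol Ω) →L[ℝ] Lp ℝ 2 (vol Ω) :=
  (ContinuousLinearMap.mul ℝ ℝ).holderL (vol Ω) 4 4 2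

/-- The product `L^∞ × L² → L²`. -/
def mulLInf (Ω : Set (Eucl N)) : LInf Ω →L[ℝ] Lp ℝ 2 (vol Ω) →L[ℝ] Lp ℝ 2 (vol Ω) :=
  (ContinuousLinearMap.mul ℝ ℝ).holderL (vol Ω) ⊤ 2 2

lemma coeFn_mulL4 (f g : Lp ℝ 4 (vol Ω)) : mulL4 Ω f g =ᵐ[vol Ω] fun x => f x * g x :=
  (ContinuousLinearMap.mul ℝ ℝ).coeFn_holder f g

lemma coeFn_mulLInf (f : LInf Ω) (g : Lp ℝ 2 (vol Ω)) :
    mulLInf Ω f g =ᵐ[vol Ω] fun x => f x * g x :=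
  (ContinuousLinearMap.mul ℝ ℝ).coeFn_holder f g

lemma norm_mulL4_le (f g : Lp ℝ 4 (vol Ω)) : ‖mulL4 Ω f g‖ ≤ ‖f‖ * ‖g‖ := by
  have h := (ContinuousLinearMap.mul ℝ ℝ).norm_holder_apply_apply_le (r := 2) f g
  rwa [ContinuousLinearMap.opNorm_mul, one_mul] at h

lemma norm_mulLInf_le (f : LInf Ω) (g : Lp ℝ 2 (vol Ω)) : ‖mulLInf Ω f g‖ ≤ ‖f‖ * ‖g‖ := by
  have h := (ContinuousLinearMap.mul ℝ ℝ).norm_holder_apply_apply_le (r := 2) f g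
  rwa [ContinuousLinearMap.opNorm_mul, one_mul] at h

lemma integrable_grad_sq (u : H01 Ω) : Integrable (fun x => ‖grad u x‖ ^ 2) (vol Ω) :=
  (memLp_grad u).norm.integrable_sq

lemma integrable_val_sq (u : H01 Ω) : Integrable (fun x => val u x ^ 2) (vol Ω) :=
  (memLp_val u).integrable_sq

lemma potential_ae (V : LInf Ω) (u : H01 Ω) :
    (fun x => inner ℝ (mulLInf Ω V (toL2 Ω u) x) (toL2 Ω u x)) =ᵐ[vol Ω]
      fun x => V x * val u x ^ 2 := by
  filter_upwards [coeFn_mulLInf V (toL2 Ω u)] with x hx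
  rw [hx, coe_toL2]
  simp
  ring

lemma integrable_potential (V : LInf Ω) (u : H01 Ω) :
    Integrable (fun x => V x * val u x ^ 2) (vol Ω) :=
  (L2.integrable_inner (𝕜 := ℝ) _ _).congr (potential_ae V u)

lemma normSq_eq (V : LInf Ω) (u : H01 Ω) :
    normSq V u = ‖gradL2 Ω u‖ ^ 2 + inner ℝ (mulLInf Ω V (toL2 Ω u)) (toL2 Ω u) := by
  rw [normSq, integral_add (integrable_grad_sq u) (integrable_potential V u), norm_sq_gradL2,
    L2.inner_def, integral_congr_ae (potential_ae V u)]

/-- Isolates the only term that is not continuous under bounded weak convergence, `‖u‖ ^ 2`; the two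
others depend on the L² class of u alone. -/
lemma normSq_eq' (V : LInf Ω) (u : H01 Ω) :
    normSq V u = ‖u‖ ^ 2 - ‖toL2 Ω u‖ ^ 2 + inner ℝ (mulLInf Ω V (toL2 Ω u)) (toL2 Ω u) := by
  rw [normSq_eq, norm_sq_eq_add]; ring

lemma norm_toL2_le (u : H01 Ω) : ‖toL2 Ω u‖ ≤ ‖u‖ := by
  refine le_of_sq_le_sq ?_ (norm_nonneg _)
  rw [norm_sq_eq_add u]
  linarith [sq_nonneg ‖gradL2 Ω u‖]

lemma integral_grad_sq_le (u : H01 Ω) : ∫ x, ‖grad u x‖ ^ 2 ∂(vol Ω) ≤ ‖u‖ ^ 2 := by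
  rw [← norm_sq_gradL2, norm_sq_eq_add u]
  linarith [sq_nonneg ‖toL2 Ω u‖]

/-- Transfers coercivity from the limit potential to potentials close to it in L^∞, with a constant
independent of n. -/
lemma normSq_sub_le (V W : LInf Ω) (u : H01 Ω) :
    normSq W u - ‖V - W‖ * ‖u‖ ^ 2 ≤ normSq V u := by
  have h : normSq V u - normSq W u = inner ℝ (mulLInf Ω (V - W) (toL2 Ω u)) (toL2 Ω u) := by
    rw [normSq_eq, normSq_eq, map_sub, _root_.sub_apply, inner_sub_left]
    ring
  have h2 : |inner ℝ (mulLInf Ω (V - W) (toL2 Ω u)) (toL2 Ω u)| ≤ ‖V - W‖ * ‖u‖ ^ 2 := by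
    calc _ ≤ ‖mulLInf Ω (V - W) (toL2 Ω u)‖ * ‖toL2 Ω u‖ := abs_real_inner_le_norm _ _
      _ ≤ ‖V - W‖ * ‖toL2 Ω u‖ * ‖toL2 Ω u‖ := by gcongr; exact norm_mulLInf_le _ _
      _ ≤ ‖V - W‖ * ‖u‖ * ‖u‖ := by gcongr <;> exact norm_toL2_le u
      _ = _ := by ring
  linarith [neg_abs_le (inner ℝ (mulLInf Ω (V - W) (toL2 Ω u)) (toL2 Ω u))]

lemma tendsto_clm₂ {ι E F G : Type*} [NormedAddCommGroup E] [NormedSpace ℝ E]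
    [NormedAddCommGroup F] [NormedSpace ℝ F] [NormedAddCommGroup G] [NormedSpace ℝ G]
    (L : E →L[ℝ] F →L[ℝ] G) {l : Filter ι} {f : ι → E} {g : ι → F} {a : E} {b : F}
    (hf : Tendsto f l (𝓝 a)) (hg : Tendsto g l (𝓝 b)) :
    Tendsto (fun n => L (f n) (g n)) l (𝓝 (L a b)) :=
  (L.continuous₂.tendsto (a, b)).comp (hf.prodMk_nhds hg)

lemma tendsto_potential {ι : Type*} {l : Filter ι} {V : ι → LInf Ω} {W : LInf Ω}
    {f : ι → Lp ℝ 2 (vol Ω)} {g : Lp ℝ 2 (vol Ω)} (hV : Tendsto V l (𝓝 W))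
    (hf : Tendsto f l (𝓝 g)) :
    Tendsto (fun n => inner ℝ (mulLInf Ω (V n) (f n)) (f n)) l (𝓝 (inner ℝ (mulLInf Ω W g) g)) := by
  have h : Tendsto (fun n => mulLInf Ω (V n) (f n)) l (𝓝 (mulLInf Ω W g)) :=
    tendsto_clm₂ (mulLInf Ω) hV hf
  exact h.inner hf

lemma tendsto_normSq_left {ι : Type*} {l : Filter ι} {V : ι → LInf Ω} {W : LInf Ω}
    (hV : Tendsto V l (𝓝 W)) (u : H01 Ω) :
    Tendsto (fun n => normSq (V n) u) l (𝓝 (normSq W u)) := by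
  simp_rw [normSq_eq]
  exact (tendsto_potential hV tendsto_const_nhds).const_add _

lemma val_smul (c : ℝ) (u : H01 Ω) : val (c • u) =ᵐ[vol Ω] fun x => c * val u x :=
  Lp.coeFn_smul c (toL2 Ω u)

lemma normSq_smul (V : LInf Ω) (c : ℝ) (u : H01 Ω) : normSq V (c • u) = c ^ 2 * normSq V u := by
  simp only [normSq_eq, map_smul, norm_smul, real_inner_smul_left, real_inner_smul_right, mul_pow,
    Real.norm_eq_abs, sq_abs]
  ring

lemma coupling_smul (β : LInf Ω) (s t : ℝ) (u v : H01 Ω) :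
    coupling β (s • u) (t • v) = s ^ 2 * t ^ 2 * coupling β u v := by
  rw [coupling, coupling, ← integral_const_mul]
  refine integral_congr_ae ?_
  filter_upwards [val_smul s u, val_smul t v] with x h1 h2
  rw [h1, h2]; ring

lemma integral_sq_mul_sq_smul (s t : ℝ) (u v : H01 Ω) :
    ∫ x, val (s • u) x ^ 2 * val (t • v) x ^ 2 ∂(vol Ω) =
      s ^ 2 * t ^ 2 * ∫ x, val u x ^ 2 * val v x ^ 2 ∂(vol Ω) := by
  rw [← integral_const_mul]
  refine integral_congr_ae ?_
  filter_upwards [val_smul s u, val_smul t v] with x h1 h2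
  rw [h1, h2]; ring

lemma coupling_comm (β : LInf Ω) (u v : H01 Ω) : coupling β u v = coupling β v u := by
  refine integral_congr_ae (.of_forall fun x => ?_)
  ring

lemma coupling_zero_left (u v : H01 Ω) : coupling 0 u v = 0 := by
  refine integral_eq_zero_of_ae ?_
  filter_upwards [Lp.coeFn_zero ℝ ⊤ (vol Ω)] with x hx
  rw [hx]
  simp

lemma coupling_nonneg {β : LInf Ω} (hβ : ∀ᵐ x ∂(vol Ω), 0 ≤ β x) (u v : H01 Ω) :
    0 ≤ coupling β u v := by
  refine integral_nonneg_of_ae ?_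
  filter_upwards [hβ] with x hx
  rw [mul_assoc]
  exact mul_nonneg hx (mul_nonneg (sq_nonneg _) (sq_nonneg _))

lemma negCoupling_nonneg (β : LInf Ω) (u v : H01 Ω) : 0 ≤ negCoupling β u v :=
  integral_nonneg fun _ => mul_nonneg (le_max_right _ _) (sq_nonneg _)

lemma negCoupling_eq_zero {β : LInf Ω} (hβ : ∀ᵐ x ∂(vol Ω), 0 ≤ β x) (u v : H01 Ω) :
    negCoupling β u v = 0 := by
  refine integral_eq_zero_of_ae ?_
  filter_upwards [hβ] with x hx
  simp [hx]

lemma negCoupling_eq_neg {β : LInf Ω} (hβ : ∀ᵐ x ∂(vol Ω), β x ≤ 0) (u v : H01 Ω) :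
    negCoupling β u v = -coupling β u v := by
  rw [negCoupling, coupling, ← integral_neg]
  refine integral_congr_ae ?_
  filter_upwards [hβ] with x hx
  rw [max_eq_left (neg_nonneg.2 hx)]
  ring

section Embedding

variable {T : H01 Ω →L[ℝ] Lp ℝ 4 (vol Ω)} (hT : ∀ u, T u =ᵐ[vol Ω] val u)
include hT

lemma coeFn_sq (u : H01 Ω) : mulL4 Ω (T u) (T u) =ᵐ[vol Ω] fun x => val u x ^ 2 := by
  filter_upwards [coeFn_mulL4 (T u) (T u), hT u] with x h1 h2
  rw [h1, h2, sq]

lemma coupling_ae (β : LInf Ω) (u v : H01 Ω) :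
    (fun x => inner ℝ (mulLInf Ω β (mulL4 Ω (T u) (T u)) x) (mulL4 Ω (T v) (T v) x)) =ᵐ[vol Ω]
      fun x => β x * val u x ^ 2 * val v x ^ 2 := by
  filter_upwards [coeFn_mulLInf β (mulL4 Ω (T u) (T u)), coeFn_sq hT u, coeFn_sq hT v]
    with x h1 h2 h3
  rw [h1, h2, h3]
  simp [mul_comm]

lemma integrable_coupling (β : LInf Ω) (u v : H01 Ω) :
    Integrable (fun x => β x * val u x ^ 2 * val v x ^ 2) (vol Ω) :=
  (L2.integrable_inner (𝕜 := ℝ) _ _).congr (coupling_ae hT β u v)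

lemma coupling_eq (β : LInf Ω) (u v : H01 Ω) : coupling β u v =
    inner ℝ (mulLInf Ω β (mulL4 Ω (T u) (T u))) (mulL4 Ω (T v) (T v)) := by
  rw [coupling, L2.inner_def, integral_congr_ae (coupling_ae hT β u v)]

lemma sq_mul_sq_ae (u v : H01 Ω) :
    (fun x => inner ℝ (mulL4 Ω (T u) (T u) x) (mulL4 Ω (T v) (T v) x)) =ᵐ[vol Ω]
      fun x => val u x ^ 2 * val v x ^ 2 := by
  filter_upwards [coeFn_sq hT u, coeFn_sq hT v] with x h2 h3
  rw [h2, h3]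
  simp [mul_comm]

lemma integrable_sq_mul_sq (u v : H01 Ω) :
    Integrable (fun x => val u x ^ 2 * val v x ^ 2) (vol Ω) :=
  (L2.integrable_inner (𝕜 := ℝ) _ _).congr (sq_mul_sq_ae hT u v)

lemma integral_sq_mul_sq_eq (u v : H01 Ω) : ∫ x, val u x ^ 2 * val v x ^ 2 ∂(vol Ω) =
    inner ℝ (mulL4 Ω (T u) (T u)) (mulL4 Ω (T v) (T v)) := by
  rw [L2.inner_def, integral_congr_ae (sq_mul_sq_ae hT u v)]

lemma coupling_le (β : LInf Ω) (u v : H01 Ω) :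
    coupling β u v ≤ ‖β‖ * ‖T u‖ ^ 2 * ‖T v‖ ^ 2 := by
  rw [coupling_eq hT]
  calc _ ≤ ‖mulLInf Ω β (mulL4 Ω (T u) (T u))‖ * ‖mulL4 Ω (T v) (T v)‖ := real_inner_le_norm _ _
    _ ≤ (‖β‖ * (‖T u‖ * ‖T u‖)) * (‖T v‖ * ‖T v‖) := by
        gcongr
        · exact (norm_mulLInf_le _ _).trans (by gcongr; exact norm_mulL4_le _ _)
        · exact norm_mulL4_le _ _
    _ = _ := by ring

lemma tendsto_coupling {ι : Type*} {l : Filter ι} {β : ι → LInf Ω} {β' : LInf Ω}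
    {u v : ι → H01 Ω} {u' v' : H01 Ω} (hβ : Tendsto β l (𝓝 β'))
    (hu : Tendsto (fun n => T (u n)) l (𝓝 (T u'))) (hv : Tendsto (fun n => T (v n)) l (𝓝 (T v'))) :
    Tendsto (fun n => coupling (β n) (u n) (v n)) l (𝓝 (coupling β' u' v')) := by
  simp_rw [coupling_eq hT]
  have h : ∀ {w : ι → H01 Ω} {w' : H01 Ω}, Tendsto (fun n => T (w n)) l (𝓝 (T w')) →
      Tendsto (fun n => mulL4 Ω (T (w n)) (T (w n))) l (𝓝 (mulL4 Ω (T w') (T w'))) :=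
    fun hw => tendsto_clm₂ (mulL4 Ω) hw hw
  exact (tendsto_clm₂ (mulLInf Ω) hβ (h hu)).inner (h hv)

lemma tendsto_integral_sq_mul_sq {ι : Type*} {l : Filter ι} {u v : ι → H01 Ω} {u' v' : H01 Ω}
    (hu : Tendsto (fun n => T (u n)) l (𝓝 (T u'))) (hv : Tendsto (fun n => T (v n)) l (𝓝 (T v'))) :
    Tendsto (fun n => ∫ x, val (u n) x ^ 2 * val (v n) x ^ 2 ∂(vol Ω)) l
      (𝓝 (∫ x, val u' x ^ 2 * val v' x ^ 2 ∂(vol Ω))) := by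
  simp_rw [integral_sq_mul_sq_eq hT]
  have h : ∀ {w : ι → H01 Ω} {w' : H01 Ω}, Tendsto (fun n => T (w n)) l (𝓝 (T w')) →
      Tendsto (fun n => mulL4 Ω (T (w n)) (T (w n))) l (𝓝 (mulL4 Ω (T w') (T w'))) :=
    fun hw => tendsto_clm₂ (mulL4 Ω) hw hw
  exact (h hu).inner (h hv)

lemma val_mul_val_ae_eq_zero {u v : H01 Ω}
    (h : ∫ x, val u x ^ 2 * val v x ^ 2 ∂(vol Ω) = 0) :
    ∀ᵐ x ∂(vol Ω), val u x * val v x = 0 := by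
  have h1 := (integral_eq_zero_iff_of_nonneg_ae
    (.of_forall fun x => mul_nonneg (sq_nonneg _) (sq_nonneg _)) (integrable_sq_mul_sq hT u v)).1 h
  filter_upwards [h1] with x hx
  simpa using hx

lemma coupling_eq_zero_of_segregated (β : LInf Ω) {u v : H01 Ω}
    (h : ∫ x, val u x ^ 2 * val v x ^ 2 ∂(vol Ω) = 0) : coupling β u v = 0 := by
  refine integral_eq_zero_of_ae ?_
  filter_upwards [val_mul_val_ae_eq_zero hT h] with x hx
  rw [mul_assoc, ← mul_pow, hx]
  simp

lemma negCoupling_eq_zero_of_segregated (β : LInf Ω) {u v : H01 Ω}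
    (h : ∫ x, val u x ^ 2 * val v x ^ 2 ∂(vol Ω) = 0) : negCoupling β u v = 0 := by
  refine integral_eq_zero_of_ae ?_
  filter_upwards [val_mul_val_ae_eq_zero hT h] with x hx
  rw [hx]
  simp

lemma mul_integral_le_coupling {β : LInf Ω} {c : ℝ} (hβ : ∀ᵐ x ∂(vol Ω), c ≤ β x) (u v : H01 Ω) :
    c * ∫ x, val u x ^ 2 * val v x ^ 2 ∂(vol Ω) ≤ coupling β u v := by
  rw [← integral_const_mul]
  refine integral_mono_ae ((integrable_sq_mul_sq hT u v).const_mul c)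
    (integrable_coupling hT β u v) ?_
  filter_upwards [hβ] with x hx
  simp only [mul_assoc]
  exact mul_le_mul_of_nonneg_right hx (mul_nonneg (sq_nonneg _) (sq_nonneg _))

lemma coupling_le_mul_integral {β : LInf Ω} {c : ℝ} (hβ : ∀ᵐ x ∂(vol Ω), β x ≤ c) (u v : H01 Ω) :
    coupling β u v ≤ c * ∫ x, val u x ^ 2 * val v x ^ 2 ∂(vol Ω) := by
  rw [← integral_const_mul]
  refine integral_mono_ae (integrable_coupling hT β u v)
    ((integrable_sq_mul_sq hT u v).const_mul c) ?_
  filter_upwards [hβ] with x hx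
  simp only [mul_assoc]
  exact mul_le_mul_of_nonneg_right hx (mul_nonneg (sq_nonneg _) (sq_nonneg _))

lemma eLpNorm_four_toReal (u : H01 Ω) : (eLpNorm (val u) 4 (vol Ω)).toReal = ‖T u‖ := by
  rw [Lp.norm_def, eLpNorm_congr_ae (hT u)]

lemma integral_sq_mul_sq_pos {u : H01 Ω} (hu : 0 < ‖T u‖) :
    0 < ∫ x, val u x ^ 2 * val u x ^ 2 ∂(vol Ω) := by
  refine lt_of_le_of_ne (integral_nonneg fun x => mul_nonneg (sq_nonneg _) (sq_nonneg _)) ?_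
  intro h
  have h0 : T u = 0 := by
    refine Lp.ext ?_
    filter_upwards [val_mul_val_ae_eq_zero hT h.symm, hT u, Lp.coeFn_zero ℝ 4 (vol Ω)]
      with x h1 h2 h3
    rw [h2, h3]
    simpa using h1
  simp [h0] at hu

end Embedding

/-! ### Poincaré inequality and coercivity -/

/-- The Poincaré inequality. -/
lemma exists_poincare (hN : 1 ≤ N) (hN3 : N ≤ 3) (hΩb : Bornology.IsBounded Ω) :
    ∃ P : ℝ, 0 ≤ P ∧ ∀ u : H01 Ω, ‖toL2 Ω u‖ ^ 2 ≤ P * ‖gradL2 Ω u‖ ^ 2 := by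
  obtain ⟨C, hC, h⟩ := exists_sobolev hN hN3 hΩb
  have hfin : IsFiniteMeasure (vol Ω) := ⟨by simpa using hΩb.measure_lt_top⟩
  set D : ℝ≥0∞ := C * vol Ω univ ^ (1 / (2 : ℝ≥0∞).toReal - 1 / (6 : ℝ≥0∞).toReal) with hD
  have hD' : D ≠ ⊤ := ENNReal.mul_ne_top hC
    (ENNReal.rpow_lt_top_of_nonneg (by norm_num) (measure_ne_top _ _)).ne
  refine ⟨D.toReal ^ 2, by positivity, fun u => ?_⟩
  rw [← mul_pow]
  gcongr
  have h1 : eLpNorm (val u) 2 (vol Ω) ≤ D * eLpNorm (grad u) 2 (vol Ω) := by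
    refine (eLpNorm_le_eLpNorm_mul_rpow_measure_univ (q := 6) (by norm_num)
      (val_aestronglyMeasurable u)).trans ?_
    rw [hD, mul_assoc, mul_comm (_ ^ _), ← mul_assoc]
    exact mul_le_mul_left (h u) _
  have h2 := ENNReal.toReal_mono (ENNReal.mul_ne_top hD' (memLp_grad u).2.ne) h1
  rw [ENNReal.toReal_mul] at h2
  exact h2

lemma firstEigenvalue_mul_le (u : H01 Ω) :
    firstEigenvalue Ω * ‖toL2 Ω u‖ ^ 2 ≤ ‖gradL2 Ω u‖ ^ 2 := by
  rcases eq_or_ne (‖toL2 Ω u‖ ^ 2) 0 with h | h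
  · rw [h, mul_zero]; positivity
  · have hpos : 0 < ‖toL2 Ω u‖ ^ 2 := lt_of_le_of_ne (by positivity) h.symm
    rw [← le_div_iff₀ hpos, norm_sq_toL2, norm_sq_gradL2]
    refine csInf_le ⟨0, ?_⟩ ⟨u, ?_, rfl⟩
    · rintro r ⟨v, -, rfl⟩
      exact div_nonneg (integral_nonneg fun x => by positivity)
        (integral_nonneg fun x => sq_nonneg _)
    · rintro rfl
      simp at h

/-- If r < 0 then λ₁ > -r > 0, and the Rayleigh bound absorbs the potential while leaving the
fraction 1 + r / λ₁ > 0 of the Dirichlet energy; if r ≥ 0 there is nothing to absorb. Poincaré then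
recovers the full norm, at the price of the factor 1 / (1 + P). -/
lemma exists_coercive (hN : 1 ≤ N) (hN3 : N ≤ 3) (hΩb : Bornology.IsBounded Ω) {V : LInf Ω} {r : ℝ}
    (hr : -firstEigenvalue Ω < r) (hV : ∀ᵐ x ∂(vol Ω), r ≤ V x) :
    ∃ c : ℝ, 0 < c ∧ ∀ u : H01 Ω, c * ‖u‖ ^ 2 ≤ normSq V u := by
  obtain ⟨P, hP, hPu⟩ := exists_poincare hN hN3 hΩb
  have h1 : ∀ u : H01 Ω, ‖gradL2 Ω u‖ ^ 2 + r * ‖toL2 Ω u‖ ^ 2 ≤ normSq V u := fun u => by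
    rw [norm_sq_gradL2, norm_sq_toL2, normSq, ← integral_const_mul,
      ← integral_add (integrable_grad_sq u) ((integrable_val_sq u).const_mul r)]
    refine integral_mono_ae ((integrable_grad_sq u).add ((integrable_val_sq u).const_mul r))
      ((integrable_grad_sq u).add (integrable_potential V u)) ?_
    filter_upwards [hV] with x hx
    have := mul_le_mul_of_nonneg_right hx (sq_nonneg (val u x))
    linarith
  suffices h : ∃ k : ℝ, 0 < k ∧ ∀ u : H01 Ω,
      k * ‖gradL2 Ω u‖ ^ 2 ≤ ‖gradL2 Ω u‖ ^ 2 + r * ‖toL2 Ω u‖ ^ 2 by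
    obtain ⟨k, hk, hku⟩ := h
    refine ⟨k / (1 + P), by positivity, fun u => ?_⟩
    refine le_trans ?_ ((hku u).trans (h1 u))
    rw [div_mul_eq_mul_div, div_le_iff₀ (by positivity), norm_sq_eq_add u, mul_assoc]
    gcongr
    linarith [hPu u]
  rcases le_or_gt 0 r with h0 | h0
  · refine ⟨1, one_pos, fun u => ?_⟩
    have := mul_nonneg h0 (sq_nonneg ‖toL2 Ω u‖)
    linarith
  · have hl : 0 < firstEigenvalue Ω := by linarith
    refine ⟨1 + r / firstEigenvalue Ω, ?_, fun u => ?_⟩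
    · rw [← neg_lt_iff_pos_add', lt_div_iff₀ hl]
      linarith
    · have h3 := mul_le_mul_of_nonneg_left (firstEigenvalue_mul_le u)
        (div_nonneg (neg_nonneg.2 h0.le) hl.le)
      have h4 : -r / firstEigenvalue Ω * (firstEigenvalue Ω * ‖toL2 Ω u‖ ^ 2) =
          -r * ‖toL2 Ω u‖ ^ 2 := by field_simp
      rw [h4, neg_div] at h3
      linarith

end Forms

/-! ### Groups of indices -/

section Groups

variable {m d : ℕ} {a : Fin (m + 1) → ℕ}

/-- The groups partition the indices, so they are the fibres of a map g. From here on membership in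
a group is an equation `g i = h`, and being in different groups is `g i ≠ g j`. -/
lemma exists_groupIndex (ha : IsDecomposition m d a) :
    ∃ g : Fin d → Fin m, ∀ i h, i ∈ group d a h ↔ g i = h := by
  obtain ⟨h0, hmono, hlast⟩ := ha
  have hex : ∀ i : Fin d, ∃ h : Fin m, a h.castSucc ≤ (i : ℕ) ∧ (i : ℕ) < a h.succ := by
    intro i
    by_contra hcon
    push Not at hcon
    have : ∀ k : Fin (m + 1), a k ≤ (i : ℕ) := by
      intro k
      induction k using Fin.induction with
      | zero => omega
      | succ k ih => exact hcon k ih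
    have h1 := this (Fin.last m)
    have := i.2
    omega
  choose g hg using hex
  refine ⟨g, fun i h => ?_⟩
  simp only [group, Finset.mem_filter, Finset.mem_univ, true_and]
  refine ⟨fun hi => ?_, fun hi => hi ▸ hg i⟩
  rcases lt_trichotomy (g i) h with hlt | heq | hgt
  · have : a (g i).succ ≤ a h.castSucc := hmono.monotone (by
      rw [Fin.le_def, Fin.val_succ, Fin.val_castSucc]; exact hlt)
    have := (hg i).2
    omega
  · exact heq
  · have : a h.succ ≤ a (g i).castSucc := hmono.monotone (by
      rw [Fin.le_def, Fin.val_succ, Fin.val_castSucc]; exact hgt)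
    have := (hg i).1
    omega

variable {g : Fin d → Fin m} (hg : ∀ i h, i ∈ group d a h ↔ g i = h)
include hg

lemma mem_K1_iff {i j : Fin d} : (i, j) ∈ K1 d a ↔ i ≠ j ∧ g i = g j := by
  simp [K1, hg, eq_comm]

lemma mem_K2_iff {i j : Fin d} : (i, j) ∈ K2 d a ↔ g i ≠ g j := by
  simp [K2, hg]

lemma group_eq_filter (h : Fin m) : group d a h = Finset.univ.filter fun i => g i = h := by
  ext i; simp [hg]

lemma sum_group (f : Fin d → ℝ) : ∑ h, ∑ i ∈ group d a h, f i = ∑ i, f i := by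
  simp_rw [group_eq_filter hg]
  exact Finset.sum_fiberwise _ _ _

end Groups

/-! ### Nehari-type sets and rescaling -/

section Nehari

variable {N : ℕ} {Ω : Set (Eucl N)} {d m : ℕ}

/-- Moving in the direction of the component u_i itself only multiplies it by 1 + t, so the energy
is a polynomial in t. Symmetry of B merges the row and column sums through i, which cancels the
factor 1/4. -/
lemma lineDeriv_energy (V : Fin d → LInf Ω) {B : Fin d → Fin d → LInf Ω}
    (hB : ∀ i j, B i j = B j i) (u : HProd Ω d) (i : Fin d) :
    partialDeriv (energy V B) u i (u i) =
      normSq (V i) (u i) - ∑ j, coupling (B i j) (u i) (u j) := by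
  have hc : ∀ k, ∀ t : ℝ, (u + t • PiLp.single 2 i (u i) : HProd Ω d) k =
      (1 + t * if k = i then 1 else 0) • u k := by
    intro k t
    by_cases hk : k = i
    · subst hk; simp [add_smul]
    · simp [hk]
  have he : ∀ t : ℝ, energy V B (u + t • PiLp.single 2 i (u i)) =
      (1 / 2) * ∑ k, (1 + t * if k = i then 1 else 0) ^ 2 * normSq (V k) (u k) -
      (1 / 4) * ∑ k, ∑ l, (1 + t * if k = i then 1 else 0) ^ 2 *
        (1 + t * if l = i then 1 else 0) ^ 2 * coupling (B k l) (u k) (u l) := by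
    intro t
    simp only [energy, hc, normSq_smul, coupling_smul]
  have hs : ∀ c : ℝ, HasDerivAt (fun t : ℝ => (1 + t * c) ^ 2) (2 * c) 0 := by
    intro c
    have := (((hasDerivAt_id (0 : ℝ)).mul_const c).const_add 1).fun_pow 2
    simpa using this
  have hsv : ∀ c : ℝ, (1 + (0 : ℝ) * c) ^ 2 = 1 := by simp
  have hd : HasDerivAt (fun t : ℝ => energy V B (u + t • PiLp.single 2 i (u i)))
      ((1 / 2) * ∑ k, (2 * if k = i then 1 else 0) * normSq (V k) (u k) -
      (1 / 4) * ∑ k, ∑ l, ((2 * if k = i then 1 else 0) * 1 + 1 * (2 * if l = i then 1 else 0)) *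
        coupling (B k l) (u k) (u l)) 0 := by
    simp_rw [he]
    refine HasDerivAt.sub (HasDerivAt.const_mul _ (HasDerivAt.fun_sum fun k _ =>
      (hs _).mul_const _)) (HasDerivAt.const_mul _ (HasDerivAt.fun_sum fun k _ =>
        HasDerivAt.fun_sum fun l _ => HasDerivAt.mul_const ?_ _))
    have := (hs (if k = i then 1 else 0)).mul (hs (if l = i then 1 else 0))
    simp only [hsv] at this
    exact this
  rw [partialDeriv, lineDeriv, hd.deriv]
  have hsym : ∑ k, coupling (B k i) (u k) (u i) = ∑ k, coupling (B i k) (u i) (u k) :=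
    Finset.sum_congr rfl fun k _ => by rw [hB k i, coupling_comm]
  simp only [mul_one, one_mul, add_mul, Finset.sum_add_distrib, mul_ite, mul_zero, ite_mul,
    zero_mul, Finset.sum_ite_eq', Finset.sum_ite_irrel, Finset.sum_const_zero, Finset.mem_univ,
    if_true, ← Finset.mul_sum, hsym]
  ring

/-- The quadratic part of the energy of a group. -/
def groupNorm (a : Fin (m + 1) → ℕ) (V : Fin d → LInf Ω) (u : HProd Ω d) (h : Fin m) : ℝ :=
  ∑ i ∈ group d a h, normSq (V i) (u i)

/-- The quartic interaction within a group. -/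
def groupCoupling (a : Fin (m + 1) → ℕ) (B : Fin d → Fin d → LInf Ω) (u : HProd Ω d)
    (h : Fin m) : ℝ :=
  ∑ i ∈ group d a h, ∑ j ∈ group d a h, coupling (B i j) (u i) (u j)

lemma mem_nehari_iff {a : Fin (m + 1) → ℕ} {V : Fin d → LInf Ω} {B : Fin d → Fin d → LInf Ω}
    (hB : ∀ i j, B i j = B j i) {u : HProd Ω d} :
    u ∈ nehari a V (energy V B) ↔ ∀ h, groupNorm a V u h ≠ 0 ∧
      groupNorm a V u h = ∑ i ∈ group d a h, ∑ j, coupling (B i j) (u i) (u j) := by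
  simp only [nehari, Set.mem_ofPred_eq, lineDeriv_energy V hB, Finset.sum_sub_distrib, sub_eq_zero,
    groupNorm]

variable {a : Fin (m + 1) → ℕ} {g : Fin d → Fin m} (hg : ∀ i h, i ∈ group d a h ↔ g i = h)
include hg

lemma sum_groupNorm (V : Fin d → LInf Ω) (u : HProd Ω d) :
    ∑ h, groupNorm a V u h = ∑ i, normSq (V i) (u i) := sum_group hg _

/-- Summing the Nehari identities over the groups makes the quartic sum equal to the quadratic one,
and 1/2 - 1/4 = 1/4. -/
lemma energy_eq_of_mem_nehari {V : Fin d → LInf Ω} {B : Fin d → Fin d → LInf Ω}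
    (hB : ∀ i j, B i j = B j i) {u : HProd Ω d} (hu : u ∈ nehari a V (energy V B)) :
    energy V B u = (1 / 4) * ∑ h, groupNorm a V u h := by
  have h1 : ∑ h, groupNorm a V u h = ∑ i, ∑ j, coupling (B i j) (u i) (u j) := by
    rw [← sum_group hg]
    exact Finset.sum_congr rfl fun h _ => ((mem_nehari_iff hB).1 hu h).2
  rw [energy, ← h1, ← sum_groupNorm hg]
  ring

omit hg in
/-- The coupling matrix with the interaction between different groups switched off. -/
def maskedCoupling (g : Fin d → Fin m) (B : Fin d → Fin d → LInf Ω) (i j : Fin d) : LInf Ω :=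
  if g i = g j then B i j else 0

lemma sum_coupling_masked (B : Fin d → Fin d → LInf Ω) (u : HProd Ω d) (h : Fin m) :
    ∑ i ∈ group d a h, ∑ j, coupling (maskedCoupling g B i j) (u i) (u j) =
      groupCoupling a B u h := by
  refine Finset.sum_congr rfl fun i hi => ?_
  rw [group_eq_filter hg, Finset.sum_filter]
  refine Finset.sum_congr rfl fun j _ => ?_
  rw [hg] at hi
  by_cases hj : g j = h
  · simp [maskedCoupling, hi, hj]
  · rw [if_neg hj, maskedCoupling, if_neg (by rw [hi]; exact fun e => hj e.symm),
      coupling_zero_left]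

/-- Makes the limit functional an instance of `energy`, so that the Nehari computations need not be
repeated for it. -/
lemma limitEnergy_eq (V : Fin d → LInf Ω) (B : Fin d → Fin d → LInf Ω) :
    limitEnergy a V B = energy V (maskedCoupling g B) := by
  funext u
  rw [limitEnergy, energy, ← sum_group hg fun i => ∑ j, coupling (maskedCoupling g B i j) (u i) (u j)]
  simp_rw [sum_coupling_masked hg]
  rfl

omit hg in
lemma maskedCoupling_symm {B : Fin d → Fin d → LInf Ω} (hB : ∀ i j, B i j = B j i) (i j : Fin d) :
    maskedCoupling g B i j = maskedCoupling g B j i := by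
  simp only [maskedCoupling, hB i j, eq_comm]

lemma mem_nehari_limit_iff {V : Fin d → LInf Ω} {B : Fin d → Fin d → LInf Ω}
    (hB : ∀ i j, B i j = B j i) {u : HProd Ω d} :
    u ∈ nehari a V (limitEnergy a V B) ↔
      ∀ h, groupNorm a V u h ≠ 0 ∧ groupNorm a V u h = groupCoupling a B u h := by
  rw [limitEnergy_eq hg, mem_nehari_iff (maskedCoupling_symm hB)]
  simp_rw [sum_coupling_masked hg]

lemma limitEnergy_eq_of_mem_nehari {V : Fin d → LInf Ω} {B : Fin d → Fin d → LInf Ω}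
    (hB : ∀ i j, B i j = B j i) {u : HProd Ω d} (hu : u ∈ nehari a V (limitEnergy a V B)) :
    limitEnergy a V B u = (1 / 4) * ∑ h, groupNorm a V u h := by
  rw [limitEnergy_eq hg] at hu ⊢
  exact energy_eq_of_mem_nehari hg (maskedCoupling_symm hB) hu

/-- Components of different groups do not overlap. -/
def IsSegregated (g : Fin d → Fin m) (u : HProd Ω d) : Prop :=
  ∀ i j, g i ≠ g j → ∫ x, val (u i) x ^ 2 * val (u j) x ^ 2 ∂(vol Ω) = 0

lemma mem_limitSet_iff {V : Fin d → LInf Ω} {B : Fin d → Fin d → LInf Ω}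
    (hB : ∀ i j, B i j = B j i) {u : HProd Ω d} :
    u ∈ limitSet a V B ↔
      (∀ h, groupNorm a V u h ≠ 0 ∧ groupNorm a V u h = groupCoupling a B u h) ∧
        IsSegregated g u := by
  simp only [limitSet, Set.mem_ofPred_eq, mem_nehari_limit_iff hg hB, IsSegregated, mem_K2_iff hg]

/-- Rescaling the groups of a segregated element. -/
lemma exists_scaled (V : Fin d → LInf Ω) (B : Fin d → Fin d → LInf Ω) {u : HProd Ω d}
    (hu : IsSegregated g u) (hq : ∀ h, 0 < groupNorm a V u h)
    (hD : ∀ h, 0 < groupCoupling a B u h) :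
    ∃ w : HProd Ω d, IsSegregated g w ∧
      (∀ h, groupNorm a V w h ≠ 0 ∧ groupNorm a V w h = groupCoupling a B w h) ∧
      ∑ h, groupNorm a V w h = ∑ h, groupNorm a V u h ^ 2 / groupCoupling a B u h := by
  -- The positive root of t² q_h = t⁴ D_h, the Nehari identity of group h for the scaled element.
  let t : Fin m → ℝ := fun h => √(groupNorm a V u h / groupCoupling a B u h)
  have ht : ∀ h, t h ^ 2 = groupNorm a V u h / groupCoupling a B u h := fun h =>
    Real.sq_sqrt (div_pos (hq h) (hD h)).le
  let w : HProd Ω d := WithLp.toLp 2 fun i => t (g i) • u i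
  have hw : ∀ i, w i = t (g i) • u i := fun i => rfl
  have h1 : ∀ h, groupNorm a V w h = t h ^ 2 * groupNorm a V u h := fun h => by
    rw [groupNorm, groupNorm, Finset.mul_sum]
    refine Finset.sum_congr rfl fun i hi => ?_
    rw [hw, normSq_smul, (hg i h).1 hi]
  have h2 : ∀ h, groupCoupling a B w h = t h ^ 2 * t h ^ 2 * groupCoupling a B u h := fun h => by
    rw [groupCoupling, groupCoupling, Finset.mul_sum]
    refine Finset.sum_congr rfl fun i hi => ?_
    rw [Finset.mul_sum]
    refine Finset.sum_congr rfl fun j hj => ?_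
    rw [hw, hw, coupling_smul, (hg i h).1 hi, (hg j h).1 hj]
  refine ⟨w, fun i j hij => ?_, fun h => ⟨?_, ?_⟩, Finset.sum_congr rfl fun h _ => ?_⟩
  · rw [hw, hw, integral_sq_mul_sq_smul, hu i j hij, mul_zero]
  · rw [h1, ht]
    exact (mul_pos (div_pos (hq h) (hD h)) (hq h)).ne'
  · rw [h1, h2, ht]
    have := (hD h).ne'
    field_simp
  · rw [h1, ht]
    ring

variable {T : H01 Ω →L[ℝ] Lp ℝ 4 (vol Ω)} (hT : ∀ u, T u =ᵐ[vol Ω] val u)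
include hT

/-- Couplings between different groups integrate to zero on a segregated element, whatever their
size. The same competitor is therefore usable for all n although those couplings diverge. -/
lemma mem_nehari_of_segregated {V : Fin d → LInf Ω} {B : Fin d → Fin d → LInf Ω}
    (hB : ∀ i j, B i j = B j i) {w : HProd Ω d} (hw : IsSegregated g w)
    (h : ∀ h, groupNorm a V w h ≠ 0 ∧ groupNorm a V w h = groupCoupling a B w h) :
    w ∈ nehari a V (energy V B) := by
  refine (mem_nehari_iff hB).2 fun k => ⟨(h k).1, (h k).2.trans ?_⟩
  refine Finset.sum_congr rfl fun i hi => ?_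
  rw [group_eq_filter hg, Finset.sum_filter]
  refine Finset.sum_congr rfl fun j _ => ?_
  split_ifs with hj
  · rfl
  · rw [coupling_eq_zero_of_segregated hT _ (hw i j ?_)]
    rw [(hg i k).1 hi]
    exact fun e => hj e.symm

/-- An upper bound for the minimal energy on the Nehari-type set. -/
lemma energy_le_of_isMinOn {V : Fin d → LInf Ω} {B : Fin d → Fin d → LInf Ω}
    (hB : ∀ i j, B i j = B j i) {v : HProd Ω d} (hv : v ∈ nehari a V (energy V B))
    (hmin : IsMinOn (energy V B) (nehari a V (energy V B)) v) {u : HProd Ω d}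
    (hu : IsSegregated g u) (hq : ∀ h, 0 < groupNorm a V u h)
    (hD : ∀ h, 0 < groupCoupling a B u h) :
    ∑ h, groupNorm a V v h ≤ ∑ h, groupNorm a V u h ^ 2 / groupCoupling a B u h := by
  obtain ⟨w, h1, h2, h3⟩ := exists_scaled hg V B hu hq hD
  have hw := mem_nehari_of_segregated hg hT hB h1 h2
  have h4 := isMinOn_iff.1 hmin w hw
  rw [energy_eq_of_mem_nehari hg hB hv, energy_eq_of_mem_nehari hg hB hw, h3] at h4
  linarith

end Nehari

/-! ### Weak limits along ultrafilters, and a segregated competitor -/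

/-- Bounded families in a Hilbert space converge weakly along ultrafilters. -/
lemma exists_weak_limit {H : Type*} [NormedAddCommGroup H] [InnerProductSpace ℝ H] [CompleteSpace H]
    {ι : Type*} (l : Ultrafilter ι) {w : ι → H} {R : ℝ} (hR : ∀ᶠ n in l, ‖w n‖ ≤ R) :
    ∃ u : H, ∀ f : H →L[ℝ] ℝ, Tendsto (fun n => f (w n)) l (𝓝 (f u)) := by
  -- Banach–Alaoglu applies to the dual; the Riesz isometry carries the sequence there and the limit
  -- back.
  let D : ι → WeakDual ℝ H := fun n => StrongDual.toWeakDual (InnerProductSpace.toDual ℝ H (w n))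
  have hK := WeakDual.isCompact_closedBall (𝕜 := ℝ) (0 : StrongDual ℝ H) R
  obtain ⟨F, -, hF⟩ := hK.ultrafilter_le_nhds (l.map D) (by
    rw [Ultrafilter.coe_map, le_principal_iff, mem_map]
    filter_upwards [hR] with n hn
    simpa [D] using hn)
  refine ⟨(InnerProductSpace.toDual ℝ H).symm (WeakDual.toStrongDual F), fun f => ?_⟩
  let y := (InnerProductSpace.toDual ℝ H).symm f
  have hy : ∀ v, f v = inner ℝ y v := fun v => (InnerProductSpace.toDual_symm_apply).symm
  have h1 : Tendsto (fun n => D n y) l (𝓝 (F y)) :=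
    ((WeakDual.eval_continuous y).tendsto F).comp hF
  have h2 : F y = f ((InnerProductSpace.toDual ℝ H).symm (WeakDual.toStrongDual F)) := by
    rw [hy, real_inner_comm, InnerProductSpace.toDual_symm_apply]
    rfl
  rw [← h2]
  refine h1.congr fun n => ?_
  rw [hy, real_inner_comm]
  rfl

lemma exists_limit_of_bounded {ι : Type*} (l : Ultrafilter ι) {f : ι → ℝ} {R : ℝ}
    (hR : ∀ᶠ n in l, |f n| ≤ R) : ∃ c, Tendsto f l (𝓝 c) := by
  obtain ⟨c, -, hc⟩ := (isCompact_Icc (a := -R) (b := R)).ultrafilter_le_nhds (l.map f) (by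
    rw [Ultrafilter.coe_map, le_principal_iff, mem_map]
    filter_upwards [hR] with n hn using abs_le.1 hn)
  exact ⟨c, hc⟩

/-- A test function defines an element of `H₀¹(Ω)`. -/
lemma exists_val_eq {N : ℕ} {Ω : Set (Eucl N)} {φ : Eucl N → ℝ} (hφ : ContDiff ℝ ∞ φ)
    (hc : HasCompactSupport φ) (ht : tsupport φ ⊆ Ω) : ∃ u : H01 Ω, val u =ᵐ[vol Ω] φ := by
  have h1 : MemLp φ 2 (vol Ω) := hφ.continuous.memLp_of_hasCompactSupport hc
  have h2 : MemLp (∇ φ) 2 (vol Ω) := by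
    have hcont : Continuous (∇ φ) :=
      (InnerProductSpace.toDual ℝ (Eucl N)).symm.continuous.comp (hφ.continuous_fderiv (by simp))
    refine hcont.memLp_of_hasCompactSupport ((hc.fderiv ℝ).mono fun x hx h => hx ?_)
    simp [gradient, h]
  let p : L2Pair Ω := WithLp.toLp 2 (h1.toLp, h2.toLp)
  have hp : p ∈ testPairs Ω := ⟨φ, hφ, hc, ht, h1.coeFn_toLp, h2.coeFn_toLp⟩
  exact ⟨⟨p, (testPairs Ω).le_topologicalClosure hp⟩, h1.coeFn_toLp⟩

/-- There are segregated elements all of whose components are nonzero. -/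
lemma exists_segregated {N d m : ℕ} (hN : 1 ≤ N) {Ω : Set (Eucl N)} (hΩ : IsOpen Ω)
    (hne : Ω.Nonempty) (g : Fin d → Fin m) :
    ∃ w : HProd Ω d, IsSegregated g w ∧ ∀ i, ¬ val (w i) =ᵐ[vol Ω] 0 := by
  have : Nonempty (Fin N) := ⟨⟨0, hN⟩⟩
  obtain ⟨x₀, hx₀⟩ := hne
  have hinf : Ω.Infinite := infinite_of_mem_nhds x₀ (hΩ.mem_nhds hx₀)
  let p : Fin m → Eucl N := fun h => hinf.natEmbedding Ω h
  have hp : ∀ h, p h ∈ Ω := fun h => (hinf.natEmbedding Ω h).2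
  have hpinj : Function.Injective p := fun h k e =>
    Fin.ext ((hinf.natEmbedding Ω).injective (Subtype.ext e))
  -- One point of Ω per group, separated by disjoint open sets; bump functions supported in these
  -- sets give the components.
  obtain ⟨U, hU, hdisj⟩ := (Set.finite_range p).t2_separation
  have hφ : ∀ h, ∃ φ : Eucl N → ℝ, tsupport φ ⊆ U (p h) ∩ Ω ∧ HasCompactSupport φ ∧
      ContDiff ℝ ∞ φ ∧ range φ ⊆ Icc 0 1 ∧ φ (p h) = 1 := fun h =>
    exists_contDiff_tsupport_subset
      (((hU _).2.inter hΩ).mem_nhds ⟨(hU (p h)).1, hp h⟩)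
  choose φ h1 h2 h3 _ h5 using hφ
  choose v hv using fun h => exists_val_eq (h3 h) (h2 h) ((h1 h).trans inter_subset_right)
  refine ⟨WithLp.toLp 2 fun i => v (g i), fun i j hij => ?_, fun i hi => ?_⟩
  · refine integral_eq_zero_of_ae ?_
    filter_upwards [hv (g i), hv (g j)] with x e1 e2
    simp only [e1, e2, Pi.zero_apply]
    have hd := hdisj (mem_range_self (g i)) (mem_range_self (g j)) (hpinj.ne hij)
    by_cases hx : φ (g i) x = 0
    · simp [hx]
    · have : φ (g j) x = 0 := by
        by_contra hx'
        exact Set.disjoint_left.1 hd (h1 _ (subset_tsupport _ hx)).1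
          (h1 _ (subset_tsupport _ hx')).1
      simp [this]
  · have h6 : φ (g i) =ᵐ[volume.restrict Ω] 0 := (hv (g i)).symm.trans hi
    have h7 := Measure.eqOn_open_of_ae_eq h6 hΩ (h3 _).continuous.continuousOn continuousOn_const
    have h8 := h7 (hp (g i))
    simp [h5] at h8

/-! ### Consequences of admissibility and a priori bounds -/

section Admissible

variable {N d m : ℕ} {Ω : Set (Eucl N)} {a : Fin (m + 1) → ℕ} {g : Fin d → Fin m}
  {V : Fin d → LInf Ω} {B : Fin d → Fin d → LInf Ω}
  (hg : ∀ i h, i ∈ group d a h ↔ g i = h) (hadm : Admissible a V B)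
include hg

lemma interGroup_eq (B : Fin d → Fin d → LInf Ω) (u : HProd Ω d) :
    interGroup a B u = ∑ i, ∑ j, if g i = g j then 0 else negCoupling (B i j) (u i) (u j) := by
  classical
  rw [interGroup, Finset.sum_filter, ← Fintype.sum_prod_type']
  refine Finset.sum_congr rfl fun p _ => ?_
  by_cases hp : g p.1 = g p.2 <;> simp [mem_K2_iff hg (i := p.1) (j := p.2), hp]

lemma negCoupling_le_interGroup (B : Fin d → Fin d → LInf Ω) (u : HProd Ω d) {i j : Fin d}
    (hij : g i ≠ g j) : negCoupling (B i j) (u i) (u j) ≤ interGroup a B u := by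
  have h : ∀ k l, 0 ≤ if g k = g l then 0 else negCoupling (B k l) (u k) (u l) := fun k l => by
    split_ifs
    · rfl
    · exact negCoupling_nonneg _ _ _
  rw [interGroup_eq hg]
  calc _ = if g i = g j then 0 else negCoupling (B i j) (u i) (u j) := (if_neg hij).symm
    _ ≤ ∑ l, if g i = g l then 0 else negCoupling (B i l) (u i) (u l) :=
        Finset.single_le_sum (f := fun l => if g i = g l then 0 else
          negCoupling (B i l) (u i) (u l)) (fun l _ => h i l) (Finset.mem_univ j)
    _ ≤ _ := Finset.single_le_sum (f := fun k => ∑ l, if g k = g l then 0 else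
          negCoupling (B k l) (u k) (u l)) (fun k _ => Finset.sum_nonneg fun l _ => h k l)
          (Finset.mem_univ i)

include hadm

lemma Admissible.ae_nonneg {i j : Fin d} (hij : g i = g j) : ∀ᵐ x ∂(vol Ω), 0 ≤ B i j x := by
  by_cases h : i = j
  · subst h
    obtain ⟨μ, hμ, h⟩ := hadm.2.2.1 i
    filter_upwards [h] with x hx using hμ.le.trans hx
  · exact hadm.2.2.2 i j ((mem_K1_iff hg).2 ⟨h, hij⟩)

lemma Admissible.sum_negCoupling (u : HProd Ω d) :
    ∑ i, ∑ j, negCoupling (B i j) (u i) (u j) = interGroup a B u := by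
  rw [interGroup_eq hg]
  refine Finset.sum_congr rfl fun i _ => Finset.sum_congr rfl fun j _ => ?_
  split_ifs with h
  · exact negCoupling_eq_zero (hadm.ae_nonneg hg h) _ _
  · rfl

omit hadm in
lemma sum_coupling_eq (hneg : ∀ i j, (i, j) ∈ K2 d a → ∀ᵐ x ∂(vol Ω), B i j x ≤ 0)
    (u : HProd Ω d) (h : Fin m) :
    ∑ i ∈ group d a h, ∑ j, coupling (B i j) (u i) (u j) = groupCoupling a B u h -
      ∑ i ∈ group d a h, ∑ j, if g i = g j then 0 else negCoupling (B i j) (u i) (u j) := by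
  rw [groupCoupling, ← Finset.sum_sub_distrib]
  refine Finset.sum_congr rfl fun i hi => ?_
  rw [group_eq_filter hg, Finset.sum_filter, ← Finset.sum_sub_distrib]
  refine Finset.sum_congr rfl fun j _ => ?_
  rw [(hg i h).1 hi]
  by_cases hj : g j = h
  · simp [hj]
  · have hij : (i, j) ∈ K2 d a := (mem_K2_iff hg).2 (by rw [(hg i h).1 hi]; exact Ne.symm hj)
    rw [if_neg hj, if_neg (Ne.symm hj), negCoupling_eq_neg (hneg i j hij)]
    ring

lemma Admissible.groupNorm_le_groupCoupling
    (hneg : ∀ i j, (i, j) ∈ K2 d a → ∀ᵐ x ∂(vol Ω), B i j x ≤ 0) {u : HProd Ω d}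
    (hu : u ∈ nehari a V (energy V B)) (h : Fin m) : groupNorm a V u h ≤ groupCoupling a B u h := by
  rw [((mem_nehari_iff hadm.1).1 hu h).2, sum_coupling_eq hg hneg]
  refine sub_le_self _ (Finset.sum_nonneg fun i _ => Finset.sum_nonneg fun j _ => ?_)
  split_ifs
  · rfl
  · exact negCoupling_nonneg _ _ _

/-- The summed Nehari identities express the interaction energy, whose coefficients diverge, through
two quantities that do have limits. -/
lemma Admissible.interGroup_eq_sub
    (hneg : ∀ i j, (i, j) ∈ K2 d a → ∀ᵐ x ∂(vol Ω), B i j x ≤ 0) {u : HProd Ω d}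
    (hu : u ∈ nehari a V (energy V B)) :
    interGroup a B u = ∑ h, groupCoupling a B u h - ∑ h, groupNorm a V u h := by
  rw [interGroup_eq hg, ← sum_group hg, ← Finset.sum_sub_distrib]
  refine Finset.sum_congr rfl fun h _ => ?_
  rw [((mem_nehari_iff hadm.1).1 hu h).2, sum_coupling_eq hg hneg]
  ring

variable {T : H01 Ω →L[ℝ] Lp ℝ 4 (vol Ω)} (hT : ∀ u, T u =ᵐ[vol Ω] val u)
include hT

lemma Admissible.groupCoupling_pos {u : HProd Ω d} {h : Fin m} {i : Fin d} (hi : i ∈ group d a h)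
    (hu : 0 < ‖T (u i)‖) : 0 < groupCoupling a B u h := by
  have hnn : ∀ k ∈ group d a h, ∀ l ∈ group d a h, 0 ≤ coupling (B k l) (u k) (u l) :=
    fun k hk l hl => coupling_nonneg
      (hadm.ae_nonneg hg (((hg k h).1 hk).trans ((hg l h).1 hl).symm)) _ _
  obtain ⟨μ, hμ, hB⟩ := hadm.2.2.1 i
  calc 0 < μ * ∫ x, val (u i) x ^ 2 * val (u i) x ^ 2 ∂(vol Ω) :=
        mul_pos hμ (integral_sq_mul_sq_pos hT hu)
    _ ≤ coupling (B i i) (u i) (u i) := mul_integral_le_coupling hT hB _ _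
    _ ≤ ∑ l ∈ group d a h, coupling (B i l) (u i) (u l) :=
        Finset.single_le_sum (f := fun l => coupling (B i l) (u i) (u l)) (hnn i hi) hi
    _ ≤ groupCoupling a B u h :=
        Finset.single_le_sum (f := fun k => ∑ l ∈ group d a h, coupling (B k l) (u k) (u l))
          (fun k hk => Finset.sum_nonneg (hnn k hk)) hi

omit hadm in
lemma groupCoupling_le {b : ℝ} (hb : ∀ i j, g i = g j → ‖B i j‖ ≤ b) (u : HProd Ω d) (h : Fin m) :
    groupCoupling a B u h ≤ b * (∑ i ∈ group d a h, ‖T (u i)‖ ^ 2) ^ 2 := by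
  rw [sq, Finset.sum_mul_sum, Finset.mul_sum]
  refine Finset.sum_le_sum fun i hi => ?_
  rw [Finset.mul_sum]
  refine Finset.sum_le_sum fun j hj => ?_
  refine (coupling_le hT _ _ _).trans ?_
  rw [mul_assoc]
  gcongr
  exact hb i j (((hg i h).1 hi).trans ((hg j h).1 hj).symm)

omit hg hadm hT in
lemma le_groupNorm {c : ℝ} (hc : 0 < c) (hV : ∀ i (v : H01 Ω), c * ‖v‖ ^ 2 ≤ normSq (V i) v)
    {S : ℝ} (hS : 0 < S) (hTS : ∀ v, ‖T v‖ ≤ S * ‖v‖) (u : HProd Ω d) (h : Fin m) :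
    c / S ^ 2 * ∑ i ∈ group d a h, ‖T (u i)‖ ^ 2 ≤ groupNorm a V u h := by
  rw [Finset.mul_sum]
  refine Finset.sum_le_sum fun i _ => le_trans ?_ (hV i (u i))
  rw [div_mul_eq_mul_div, div_le_iff₀ (by positivity), mul_assoc]
  have : ‖T (u i)‖ ^ 2 ≤ (S * ‖u i‖) ^ 2 := by gcongr; exact hTS _
  gcongr
  linarith

/-- A priori bounds on the Nehari-type set. -/
lemma Admissible.bounds_of_mem_nehari
    (hneg : ∀ i j, (i, j) ∈ K2 d a → ∀ᵐ x ∂(vol Ω), B i j x ≤ 0) {u : HProd Ω d}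
    (hu : u ∈ nehari a V (energy V B)) {c b S E : ℝ} (hc : 0 < c) (hb0 : 0 < b) (hS : 0 < S)
    (hTS : ∀ v, ‖T v‖ ≤ S * ‖v‖) (hV : ∀ i (v : H01 Ω), c * ‖v‖ ^ 2 ≤ normSq (V i) v)
    (hb : ∀ i j, g i = g j → ‖B i j‖ ≤ b) (hE : ∑ h, groupNorm a V u h ≤ E) :
    ∑ i, ‖u i‖ ^ 2 ≤ E / c ∧ (∀ h, c / (S ^ 2 * b) ≤ ∑ i ∈ group d a h, ‖T (u i)‖ ^ 2) ∧
      interGroup a B u ≤ m * (b * (S ^ 2 * (E / c)) ^ 2) := by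
  have h1 : ∑ i, ‖u i‖ ^ 2 ≤ E / c := by
    rw [le_div_iff₀ hc, Finset.sum_mul]
    refine le_trans ?_ hE
    rw [sum_groupNorm hg]
    exact Finset.sum_le_sum fun i _ => by rw [mul_comm]; exact hV i (u i)
  have hq0 : ∀ h, 0 ≤ groupNorm a V u h := fun h =>
    Finset.sum_nonneg fun i _ => le_trans (by positivity) (hV i (u i))
  have hX0 : ∀ h, 0 ≤ ∑ i ∈ group d a h, ‖T (u i)‖ ^ 2 := fun h =>
    Finset.sum_nonneg fun i _ => by positivity
  refine ⟨h1, fun h => ?_, ?_⟩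
  · have h2 := (hadm.groupNorm_le_groupCoupling hg hneg hu h).trans (groupCoupling_le hg hT hb u h)
    have h3 := le_groupNorm (a := a) hc hV hS hTS u h
    set X := ∑ i ∈ group d a h, ‖T (u i)‖ ^ 2
    -- If the L⁴ norms of a group all vanished, its quartic bound would force the group norm to be
    -- zero, which the Nehari-type set excludes. Positivity allows division by X.
    have hX : 0 < X := by
      refine lt_of_le_of_ne (hX0 h) fun h0 => ?_
      rw [← h0] at h2
      norm_num at h2
      exact ((mem_nehari_iff hadm.1).1 hu h).1 (le_antisymm h2 (hq0 h))
    have h4 : c / S ^ 2 * X ≤ b * X * X := by linarith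
    have h5 := le_of_mul_le_mul_right h4 hX
    rw [← div_div, div_le_iff₀ hb0]
    linarith
  · rw [hadm.interGroup_eq_sub hg hneg hu]
    have h2 : ∀ h, groupCoupling a B u h ≤ b * (S ^ 2 * (E / c)) ^ 2 := fun h => by
      refine (groupCoupling_le hg hT hb u h).trans ?_
      have : ∑ i ∈ group d a h, ‖T (u i)‖ ^ 2 ≤ S ^ 2 * (E / c) := by
        calc _ ≤ ∑ i, ‖T (u i)‖ ^ 2 := Finset.sum_le_sum_of_subset_of_nonneg (Finset.subset_univ _)
              fun i _ _ => by positivity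
          _ ≤ ∑ i, S ^ 2 * ‖u i‖ ^ 2 := Finset.sum_le_sum fun i _ => by
              rw [← mul_pow]; gcongr; exact hTS _
          _ ≤ _ := by rw [← Finset.mul_sum]; gcongr
      have := hX0 h
      gcongr
    have h3 : 0 ≤ ∑ h, groupNorm a V u h := Finset.sum_nonneg fun h _ => hq0 h
    have h4 : ∑ h, groupCoupling a B u h ≤ ∑ _h : Fin m, b * (S ^ 2 * (E / c)) ^ 2 :=
      Finset.sum_le_sum fun h _ => h2 h
    rw [Finset.sum_const, Finset.card_univ, Fintype.card_fin, nsmul_eq_mul] at h4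
    linarith

end Admissible

/-! ### Rigidity and passage to the limit -/

/-- Rigidity in the comparison of energies. -/
lemma eq_of_sum_le_sum_sq_div {ι : Type*} [Fintype ι] {q A D : ι → ℝ} (hq : ∀ h, 0 < q h)
    (hqA : ∀ h, q h ≤ A h) (hAD : ∀ h, A h ≤ D h) (hsum : ∑ h, A h ≤ ∑ h, q h ^ 2 / D h) (h : ι) :
    A h = q h ∧ D h = q h := by
  have h1 : ∀ k, q k ^ 2 / D k ≤ q k := fun k => by
    have h2 := (hqA k).trans (hAD k)
    rw [div_le_iff₀ ((hq k).trans_le h2), sq]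
    exact mul_le_mul_of_nonneg_left h2 (hq k).le
  have h3 : ∑ k, q k ^ 2 / D k ≤ ∑ k, q k := Finset.sum_le_sum fun k _ => h1 k
  have h4 : ∑ k, q k ≤ ∑ k, A k := Finset.sum_le_sum fun k _ => hqA k
  -- The chain Σ q²/D ≤ Σ q ≤ Σ A ≤ Σ q²/D closes up, so both termwise inequalities are equalities
  -- for every index.
  have h5 := (Finset.sum_eq_sum_iff_of_le fun k _ => hqA k).1 (by linarith) h (Finset.mem_univ h)
  have h6 := (Finset.sum_eq_sum_iff_of_le fun k _ => h1 k).1 (by linarith) h (Finset.mem_univ h)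
  have hD : 0 < D h := (hq h).trans_le ((hqA h).trans (hAD h))
  refine ⟨h5.symm, ?_⟩
  rw [div_eq_iff hD.ne', sq] at h6
  exact (mul_left_cancel₀ (hq h).ne' h6).symm

section Limit

variable {N d m : ℕ} {Ω : Set (Eucl N)} {a : Fin (m + 1) → ℕ} {g : Fin d → Fin m}
  (hg : ∀ i h, i ∈ group d a h ↔ g i = h)
  {T : H01 Ω →L[ℝ] Lp ℝ 4 (vol Ω)} (hT : ∀ u, T u =ᵐ[vol Ω] val u)
  {V : ℕ → Fin d → LInf Ω} {B : ℕ → Fin d → Fin d → LInf Ω}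
  {V' : Fin d → LInf Ω} {B' : Fin d → Fin d → LInf Ω}

lemma tendsto_groupNorm_left {l : Filter ℕ} (hV : ∀ i, Tendsto (fun n => V n i) l (𝓝 (V' i)))
    (w : HProd Ω d) (h : Fin m) :
    Tendsto (fun n => groupNorm a (V n) w h) l (𝓝 (groupNorm a V' w h)) :=
  tendsto_finsetSum _ fun i _ => tendsto_normSq_left (hV i) (w i)

include hg hT

lemma tendsto_groupCoupling {l : Filter ℕ}
    (hB : ∀ i j, g i = g j → Tendsto (fun n => B n i j) l (𝓝 (B' i j))) {u : ℕ → HProd Ω d}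
    {u' : HProd Ω d} (hu : ∀ i, Tendsto (fun n => T (u n i)) l (𝓝 (T (u' i)))) (h : Fin m) :
    Tendsto (fun n => groupCoupling a (B n) (u n) h) l (𝓝 (groupCoupling a B' u' h)) :=
  tendsto_finsetSum _ fun i hi => tendsto_finsetSum _ fun j hj => tendsto_coupling hT
    (hB i j (((hg i h).1 hi).trans ((hg j h).1 hj).symm)) (hu i) (hu j)

lemma tendsto_sum_sq_div {l : Filter ℕ}
    (hV : ∀ i, Tendsto (fun n => V n i) l (𝓝 (V' i)))
    (hB : ∀ i j, g i = g j → Tendsto (fun n => B n i j) l (𝓝 (B' i j)))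
    (w : HProd Ω d) (hD : ∀ h, 0 < groupCoupling a B' w h) :
    Tendsto (fun n => ∑ h, groupNorm a (V n) w h ^ 2 / groupCoupling a (B n) w h) l
      (𝓝 (∑ h, groupNorm a V' w h ^ 2 / groupCoupling a B' w h)) :=
  tendsto_finsetSum _ fun h _ => ((tendsto_groupNorm_left hV w h).pow 2).div
    (tendsto_groupCoupling hg hT hB (u := fun _ => w) (fun _ => tendsto_const_nhds) h) (hD h).ne'

/-- The asymptotic upper bound for minimal energies. -/
lemma eventually_sum_groupNorm_lt {l : Filter ℕ} (hadm : ∀ n, Admissible a (V n) (B n))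
    (hV : ∀ i, Tendsto (fun n => V n i) l (𝓝 (V' i)))
    (hB : ∀ i j, g i = g j → Tendsto (fun n => B n i j) l (𝓝 (B' i j)))
    {u : ℕ → HProd Ω d} (hu : ∀ n, u n ∈ nehari a (V n) (energy (V n) (B n)) ∧
      IsMinOn (energy (V n) (B n)) (nehari a (V n) (energy (V n) (B n))) (u n))
    {w : HProd Ω d} (hw : IsSegregated g w) (hq : ∀ h, 0 < groupNorm a V' w h)
    (hD : ∀ h, 0 < groupCoupling a B' w h) {E : ℝ}
    (hE : ∑ h, groupNorm a V' w h ^ 2 / groupCoupling a B' w h < E) :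
    ∀ᶠ n in l, ∑ h, groupNorm a (V n) (u n) h < E := by
  have h1 : ∀ᶠ n in l, ∀ h, 0 < groupNorm a (V n) w h := eventually_all.2 fun h =>
    (tendsto_groupNorm_left hV w h).eventually_const_lt (hq h)
  have h2 : ∀ᶠ n in l, ∀ h, 0 < groupCoupling a (B n) w h := eventually_all.2 fun h =>
    (tendsto_groupCoupling hg hT hB (u := fun _ => w)
      (fun _ => tendsto_const_nhds) h).eventually_const_lt (hD h)
  filter_upwards [h1, h2, (tendsto_sum_sq_div hg hT hV hB w hD).eventually_lt_const hE]
    with n e1 e2 e3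
  exact (energy_le_of_isMinOn hg hT (hadm n).1 (hu n).1 (hu n).2 hw e1 e2).trans_lt e3

/-- Limits of minimizers along an ultrafilter. -/
theorem exists_limit_of_ultrafilter (hinf : Admissible a V' B')
    (hadm : ∀ n, Admissible a (V n) (B n))
    (hneg : ∀ n i j, (i, j) ∈ K2 d a → ∀ᵐ x ∂(vol Ω), B n i j x ≤ 0)
    (l : Ultrafilter ℕ)
    (hcompact : ∀ (w : ℕ → H01 Ω) (u : H01 Ω) (R : ℝ), (∀ᶠ n in l, ‖w n‖ ≤ R) →
      (∀ f : H01 Ω →L[ℝ] ℝ, Tendsto (fun n => f (w n)) l (𝓝 (f u))) →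
        Tendsto (fun n => toL2 Ω (w n)) l (𝓝 (toL2 Ω u)) ∧
          Tendsto (fun n => T (w n)) l (𝓝 (T u)))
    (hV : ∀ i, Tendsto (fun n => V n i) l (𝓝 (V' i)))
    (hB : ∀ i j, g i = g j → Tendsto (fun n => B n i j) l (𝓝 (B' i j)))
    (hinfty : ∀ i j, g i ≠ g j → ∀ C : ℝ, ∀ᶠ n in l, ∀ᵐ x ∂(vol Ω), B n i j x ≤ C)
    {u : ℕ → HProd Ω d} (hu : ∀ n, u n ∈ nehari a (V n) (energy (V n) (B n)) ∧
      IsMinOn (energy (V n) (B n)) (nehari a (V n) (energy (V n) (B n))) (u n))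
    {c : ℝ} (hc : 0 < c) (hcoer : ∀ i (v : H01 Ω), c * ‖v‖ ^ 2 ≤ normSq (V' i) v)
    {R γ M : ℝ} (hR : ∀ᶠ n in l, ∑ i, ‖u n i‖ ^ 2 ≤ R) (hγ : 0 < γ)
    (hlow : ∀ᶠ n in l, ∀ h, γ ≤ ∑ i ∈ group d a h, ‖T (u n i)‖ ^ 2)
    (hM : ∀ᶠ n in l, interGroup a (B n) (u n) ≤ M) :
    ∃ u' : HProd Ω d, Tendsto u l (𝓝 u') ∧ u' ∈ limitSet a V' B' ∧
      IsMinOn (limitEnergy a V' B') (limitSet a V' B') u' ∧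
        Tendsto (fun n => interGroup a (B n) (u n)) l (𝓝 0) := by
  have hR1 : ∀ i, ∀ᶠ n in l, ‖u n i‖ ^ 2 ≤ R := fun i => hR.mono fun n hn =>
    (Finset.single_le_sum (f := fun i => ‖u n i‖ ^ 2) (fun i _ => sq_nonneg _)
      (Finset.mem_univ i)).trans hn
  have hR2 : ∀ i, ∀ᶠ n in l, ‖u n i‖ ≤ √R := fun i => (hR1 i).mono fun n hn =>
    Real.le_sqrt_of_sq_le hn
  choose v hv using fun i => exists_weak_limit l (hR2 i)
  -- Along an ultrafilter the bounded squared norms converge without passing to subsequences; ℓ i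
  -- may a priori exceed the squared norm of the weak limit.
  choose ℓ hℓ using fun i => exists_limit_of_bounded l (f := fun n => ‖u n i‖ ^ 2)
    ((hR1 i).mono fun n hn => by rwa [abs_of_nonneg (sq_nonneg _)])
  let u' : HProd Ω d := WithLp.toLp 2 v
  have hL2 : ∀ i, Tendsto (fun n => toL2 Ω (u n i)) l (𝓝 (toL2 Ω (u' i))) := fun i =>
    (hcompact _ _ _ (hR2 i) (hv i)).1
  have hL4 : ∀ i, Tendsto (fun n => T (u n i)) l (𝓝 (T (u' i))) := fun i =>
    (hcompact _ _ _ (hR2 i) (hv i)).2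
  -- the defect of strong convergence
  have hdefect : ∀ i, Tendsto (fun n => ‖u n i - u' i‖ ^ 2) l (𝓝 (ℓ i - ‖u' i‖ ^ 2)) := by
    intro i
    have h1 : Tendsto (fun n => inner ℝ (u' i) (u n i)) l (𝓝 (inner ℝ (u' i) (u' i))) :=
      hv i (innerSL ℝ (u' i))
    rw [real_inner_self_eq_norm_sq] at h1
    have h2 := ((hℓ i).sub (h1.const_mul 2)).add_const (‖u' i‖ ^ 2)
    refine (h2.congr fun n => ?_).trans_eq ?_
    · rw [norm_sub_sq_real, real_inner_comm]
    · congr 1; ring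
  have hdefect0 : ∀ i, 0 ≤ ℓ i - ‖u' i‖ ^ 2 := fun i =>
    ge_of_tendsto (hdefect i) (.of_forall fun n => sq_nonneg _)
  have hnorm : ∀ i, Tendsto (fun n => normSq (V n i) (u n i)) l
      (𝓝 (normSq (V' i) (u' i) + (ℓ i - ‖u' i‖ ^ 2))) := fun i => by
    simp_rw [normSq_eq']
    have := ((hℓ i).sub ((hL2 i).norm.pow 2)).add (tendsto_potential (hV i) (hL2 i))
    refine this.trans_eq ?_
    congr 1; ring
  have hq : ∀ h, Tendsto (fun n => groupNorm a (V n) (u n) h) l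
      (𝓝 (groupNorm a V' u' h + ∑ i ∈ group d a h, (ℓ i - ‖u' i‖ ^ 2))) := fun h => by
    rw [groupNorm, ← Finset.sum_add_distrib]
    exact tendsto_finsetSum _ fun i _ => hnorm i
  have hD : ∀ h, Tendsto (fun n => groupCoupling a (B n) (u n) h) l
      (𝓝 (groupCoupling a B' u' h)) := tendsto_groupCoupling hg hT hB hL4
  have hqA : ∀ h, groupNorm a V' u' h ≤
      groupNorm a V' u' h + ∑ i ∈ group d a h, (ℓ i - ‖u' i‖ ^ 2) := fun h =>
    le_add_of_nonneg_right (Finset.sum_nonneg fun i _ => hdefect0 i)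
  have hAD : ∀ h, groupNorm a V' u' h + ∑ i ∈ group d a h, (ℓ i - ‖u' i‖ ^ 2) ≤
      groupCoupling a B' u' h := fun h =>
    le_of_tendsto_of_tendsto (hq h) (hD h)
      (.of_forall fun n => (hadm n).groupNorm_le_groupCoupling hg (hneg n) (hu n).1 h)
  -- the limit does not vanish
  have hpos : ∀ h, ∃ i ∈ group d a h, 0 < ‖T (u' i)‖ := by
    intro h
    have h1 : γ ≤ ∑ i ∈ group d a h, ‖T (u' i)‖ ^ 2 :=
      ge_of_tendsto (tendsto_finsetSum _ fun i _ => (hL4 i).norm.pow 2)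
        (hlow.mono fun n hn => hn h)
    obtain ⟨i, hi, hi2⟩ := Finset.exists_ne_zero_of_sum_ne_zero (hγ.trans_le h1).ne'
    exact ⟨i, hi, lt_of_le_of_ne (norm_nonneg _) fun e => hi2 (by rw [← e]; norm_num)⟩
  have hqpos : ∀ h, 0 < groupNorm a V' u' h := by
    intro h
    obtain ⟨i, hi, hi2⟩ := hpos h
    have h0 : u' i ≠ 0 := fun e => by rw [e, map_zero, norm_zero] at hi2; exact hi2.false
    calc 0 < c * ‖u' i‖ ^ 2 := by have := norm_pos_iff.2 h0; positivity
      _ ≤ normSq (V' i) (u' i) := hcoer _ _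
      _ ≤ _ := Finset.single_le_sum (f := fun i => normSq (V' i) (u' i))
        (fun k _ => le_trans (by positivity) (hcoer k (u' k))) hi
  have hDpos : ∀ h, 0 < groupCoupling a B' u' h := fun h => by
    obtain ⟨i, hi, hi2⟩ := hpos h
    exact hinf.groupCoupling_pos hg hT hi hi2
  -- the limit is segregated
  have hseg : IsSegregated g u' := by
    intro i j hij
    have h1 := tendsto_integral_sq_mul_sq hT (hL4 i) (hL4 j)
    -- Once the coupling is below -C, C times the overlap integral is at most the interaction
    -- energy, hence at most M. Then C → ∞.
    have h2 : ∀ C : ℝ, 0 < C → ∫ x, val (u' i) x ^ 2 * val (u' j) x ^ 2 ∂(vol Ω) ≤ M / C := by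
      intro C hC
      refine le_of_tendsto h1 ?_
      filter_upwards [hM, hinfty i j hij (-C)] with n e1 e2
      have e3 := coupling_le_mul_integral hT e2 (u n i) (u n j)
      have e4 := negCoupling_le_interGroup hg (B n) (u n) hij
      rw [negCoupling_eq_neg (hneg n i j ((mem_K2_iff hg).2 hij))] at e4
      rw [le_div_iff₀ hC]
      linarith
    refine le_antisymm ?_ (integral_nonneg fun x => mul_nonneg (sq_nonneg _) (sq_nonneg _))
    exact ge_of_tendsto (tendsto_const_nhds.div_atTop tendsto_id)
      ((eventually_gt_atTop 0).mono h2)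
  -- comparison of energies
  have hcomp : ∀ w : HProd Ω d, IsSegregated g w → (∀ h, 0 < groupNorm a V' w h) →
      (∀ h, 0 < groupCoupling a B' w h) →
      ∑ h, (groupNorm a V' u' h + ∑ i ∈ group d a h, (ℓ i - ‖u' i‖ ^ 2)) ≤
        ∑ h, groupNorm a V' w h ^ 2 / groupCoupling a B' w h := by
    intro w h1 h2 h3
    refine le_of_forall_gt_imp_ge_of_dense fun E hE => ?_
    exact le_of_tendsto (tendsto_finsetSum _ fun h _ => hq h)
      ((eventually_sum_groupNorm_lt hg hT hadm hV hB hu h1 h2 h3 hE).mono fun n hn => hn.le)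
  -- The competitor is the limit itself, rescaled group by group.
  have hrigid := eq_of_sum_le_sum_sq_div hqpos hqA hAD (hcomp u' hseg hqpos hDpos)
  have hmem : u' ∈ limitSet a V' B' := (mem_limitSet_iff hg hinf.1).2
    ⟨fun h => ⟨(hqpos h).ne', (hrigid h).2.symm⟩, hseg⟩
  have hzero : ∀ i, ℓ i - ‖u' i‖ ^ 2 = 0 := by
    intro i
    have h1 := (hrigid (g i)).1
    rw [add_eq_left, Finset.sum_eq_zero_iff_of_nonneg fun i _ => hdefect0 i] at h1
    exact h1 i ((hg i _).2 rfl)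
  refine ⟨u', ?_, hmem, isMinOn_iff.2 fun w hw => ?_, ?_⟩
  · have h1 : ∀ i, Tendsto (fun n => u n i) l (𝓝 (u' i)) := fun i => by
      rw [tendsto_iff_norm_sub_tendsto_zero]
      have := (hdefect i).sqrt
      rw [hzero i, Real.sqrt_zero] at this
      exact this.congr fun n => Real.sqrt_sq (norm_nonneg _)
    have h2 : Tendsto (fun n => WithLp.ofLp (u n)) l (𝓝 (WithLp.ofLp u')) := tendsto_pi_nhds.2 h1
    exact ((PiLp.continuous_toLp 2 _).tendsto _).comp h2
  · have hw' := (mem_limitSet_iff hg hinf.1).1 hw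
    rw [limitEnergy_eq_of_mem_nehari hg hinf.1 hmem.1, limitEnergy_eq_of_mem_nehari hg hinf.1 hw.1]
    have hwpos : ∀ h, 0 < groupNorm a V' w h := fun h =>
      lt_of_le_of_ne (Finset.sum_nonneg fun i _ => le_trans (by positivity) (hcoer i (w i)))
        (hw'.1 h).1.symm
    have h1 := hcomp w hw'.2 hwpos fun h => (hw'.1 h).2 ▸ hwpos h
    -- An element of the limit set already has q_h = D_h, so its rescaling factor is 1 and the bound
    -- is its own total norm.
    have h2 : ∀ h, groupNorm a V' w h ^ 2 / groupCoupling a B' w h = groupNorm a V' w h :=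
      fun h => by rw [← (hw'.1 h).2, sq, mul_div_cancel_right₀ _ (hw'.1 h).1]
    simp_rw [h2] at h1
    have h3 : ∑ h, groupNorm a V' u' h ≤
        ∑ h, (groupNorm a V' u' h + ∑ i ∈ group d a h, (ℓ i - ‖u' i‖ ^ 2)) :=
      Finset.sum_le_sum fun h _ => hqA h
    linarith
  · have h1 := (tendsto_finsetSum Finset.univ fun h _ => hD h).sub
      (tendsto_finsetSum Finset.univ fun h _ => hq h)
    refine (h1.congr fun n => ?_).trans_eq ?_
    · rw [(hadm n).interGroup_eq_sub hg (hneg n) (hu n).1]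
    · rw [← Finset.sum_sub_distrib, Finset.sum_eq_zero fun h _ => ?_]
      rw [(hrigid h).1, (hrigid h).2, sub_self]

end Limit

end Segregation

end

/-! ### The main theorem -/

open Segregation in
theorem theorem1p9 {N : ℕ} (hN : 1 ≤ N) (hN3 : N ≤ 3)
    (Ω : Set (Eucl N)) (hΩ : IsOpen Ω) (hΩb : Bornology.IsBounded Ω)
    {d m : ℕ} (a : Fin (m + 1) → ℕ) (ha : IsDecomposition m d a)
    (Vinf : Fin d → LInf Ω) (Binf : Fin d → Fin d → LInf Ω) (hinf : Admissible a Vinf Binf) :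
    -- the constants in the estimates depend only on the data fixed so far
    ∃ γU γL M : ℝ, 0 < γU ∧ 0 < γL ∧ 0 < M ∧
      ∀ (V : ℕ → Fin d → LInf Ω) (B : ℕ → Fin d → Fin d → LInf Ω),
        (∀ n, Admissible a (V n) (B n)) →
        (∀ n, ∀ i j, (i, j) ∈ K2 d a → ∀ᵐ x ∂(vol Ω), B n i j x ≤ 0) →
        (∀ i, Tendsto (fun n => V n i) atTop (𝓝 (Vinf i))) →
        (∀ i, Tendsto (fun n => B n i i) atTop (𝓝 (Binf i i))) →
        (∀ i j, (i, j) ∈ K1 d a → Tendsto (fun n => B n i j) atTop (𝓝 (Binf i j))) →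
        -- `β_ij^n → -∞` uniformly, between different groups
        (∀ i j, (i, j) ∈ K2 d a →
          ∀ C : ℝ, ∀ᶠ n in atTop, ∀ᵐ x ∂(vol Ω), B n i j x ≤ C) →
        ∀ u : ℕ → HProd Ω d,
          (∀ n, u n ∈ nehari a (V n) (energy (V n) (B n)) ∧
            IsMinOn (energy (V n) (B n)) (nehari a (V n) (energy (V n) (B n))) (u n)) →
          (∀ᶠ n in atTop, Estimates a (B n) γU γL M (u n)) ∧
          (∃ uinf : HProd Ω d, ∃ φ : ℕ → ℕ, StrictMono φ ∧
            Tendsto (fun k => u (φ k)) atTop (𝓝 uinf) ∧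
            uinf ∈ limitSet a Vinf Binf ∧
            IsMinOn (limitEnergy a Vinf Binf) (limitSet a Vinf Binf) uinf ∧
            ∀ n, Estimates a (B n) γU γL M uinf) ∧
          Tendsto (fun n => interGroup a (B n) (u n)) atTop (𝓝 0) := by
  obtain ⟨g, hg⟩ := exists_groupIndex ha
  obtain ⟨T, hT, hTc⟩ := exists_toL4 hN hN3 hΩb
  obtain ⟨c, hc, hcoer⟩ : ∃ c : ℝ, 0 < c ∧
      ∀ i (v : H01 Ω), c * ‖v‖ ^ 2 ≤ normSq (Vinf i) v := by
    have h : ∀ i, ∃ c : Set.Ioi (0 : ℝ), ∀ v : H01 Ω, (c : ℝ) * ‖v‖ ^ 2 ≤ normSq (Vinf i) v := by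
      intro i
      obtain ⟨r, hr, hV⟩ := hinf.2.1 i
      obtain ⟨c, hc, h⟩ := exists_coercive hN hN3 hΩb hr hV
      exact ⟨⟨c, hc⟩, h⟩
    choose c hc using h
    obtain ⟨c₀, h₀⟩ := Finite.exists_ge c
    exact ⟨c₀, c₀.2, fun i v => le_trans (by gcongr; exact h₀ i) (hc i v)⟩
  obtain ⟨S, hS, hTS⟩ : ∃ S : ℝ, 0 < S ∧ ∀ v, ‖T v‖ ≤ S * ‖v‖ :=
    ⟨‖T‖ + 1, by positivity, fun v => (T.le_opNorm v).trans (by gcongr; linarith)⟩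
  obtain ⟨b, hb, hbB⟩ : ∃ b : ℝ, 0 < b ∧ ∀ i j, ‖Binf i j‖ < b := by
    obtain ⟨b₀, h₀⟩ := Finite.exists_le fun p : Fin d × Fin d => ‖Binf p.1 p.2‖
    exact ⟨|b₀| + 1, by positivity, fun i j =>
      ((h₀ (i, j)).trans (le_abs_self b₀)).trans_lt (lt_add_one _)⟩
  -- a competitor for the limit problem
  have hex : (∃ w : HProd Ω d, IsSegregated g w ∧ (∀ h, 0 < groupNorm a Vinf w h) ∧
      ∀ h, 0 < groupCoupling a Binf w h) ∨ (Ω = ∅ ∧ 0 < m) := by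
    rcases Ω.eq_empty_or_nonempty with hem | hne
    · rcases m.eq_zero_or_pos with rfl | hm
      · exact .inl ⟨0, fun i => (g i).elim0, fun h => h.elim0, fun h => h.elim0⟩
      · exact .inr ⟨hem, hm⟩
    · left
      obtain ⟨w, hw, hw0⟩ := exists_segregated (d := d) hN hΩ hne g
      have hTw : ∀ i, 0 < ‖T (w i)‖ := fun i => by
        refine lt_of_le_of_ne (norm_nonneg _) fun h => hw0 i ?_
        have h1 := norm_eq_zero.1 h.symm
        refine (hT (w i)).symm.trans ?_
        rw [h1]
        exact Lp.coeFn_zero ℝ 4 (vol Ω)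
      have hgr : ∀ h, ∃ i, i ∈ group d a h := fun h => by
        have h1 : a h.castSucc < a h.succ := ha.2.1 Fin.castSucc_lt_succ
        have h2 : a h.succ ≤ d := ha.2.2 ▸ ha.2.1.monotone (Fin.le_last _)
        exact ⟨⟨a h.castSucc, by omega⟩, by simp [group, h1]⟩
      refine ⟨w, hw, fun h => ?_, fun h => ?_⟩
      · obtain ⟨i, hi⟩ := hgr h
        refine lt_of_lt_of_le ?_ (le_groupNorm (a := a) hc hcoer hS hTS w h)
        refine mul_pos (by positivity) (lt_of_lt_of_le (pow_pos (hTw i) 2) ?_)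
        exact Finset.single_le_sum (f := fun i => ‖T (w i)‖ ^ 2) (fun _ _ => sq_nonneg _) hi
      · obtain ⟨i, hi⟩ := hgr h
        exact hinf.groupCoupling_pos hg hT hi (hTw i)
  rcases hex with ⟨w, hw, hwq, hwD⟩ | ⟨rfl, hm⟩
  swap
  · refine ⟨1, 1, 1, one_pos, one_pos, one_pos, fun V B _ _ _ _ _ _ u hu => ?_⟩
    refine absurd (Finset.sum_eq_zero fun i _ => ?_) ((hu 0).1 ⟨0, hm⟩).1
    simp [normSq]
  set E := ∑ h, groupNorm a Vinf w h ^ 2 / groupCoupling a Binf w h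
  have hE : 0 ≤ E := Finset.sum_nonneg fun h _ => div_nonneg (sq_nonneg _) (hwD h).le
  have hc2 : 0 < c / 2 := by positivity
  -- E + 1 bounds the total norm of the minimizers for large n, and half of the limit coercivity c
  -- survives the perturbation of the potentials. The last summand 1 keeps M positive when m = 0.
  refine ⟨(E + 1) / (c / 2), c / 2 / (S ^ 2 * b),
    m * (b * (S ^ 2 * ((E + 1) / (c / 2))) ^ 2) + 1, by positivity, by positivity, by positivity,
    fun V B hadm hneg hV hBd hB1 hinfty u hu => ?_⟩
  have hB : ∀ i j, g i = g j → Tendsto (fun n => B n i j) atTop (𝓝 (Binf i j)) := by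
    intro i j hij
    by_cases h : i = j
    · subst h; exact hBd i
    · exact hB1 i j ((mem_K1_iff hg).2 ⟨h, hij⟩)
  have hbounds : ∀ᶠ n in atTop, ∑ i, ‖u n i‖ ^ 2 ≤ (E + 1) / (c / 2) ∧
      (∀ h, c / 2 / (S ^ 2 * b) ≤ ∑ i ∈ group d a h, ‖T (u n i)‖ ^ 2) ∧
      interGroup a (B n) (u n) ≤ m * (b * (S ^ 2 * ((E + 1) / (c / 2))) ^ 2) := by
    have e1 : ∀ᶠ n in atTop, ∀ i, ‖V n i - Vinf i‖ < c / 2 := eventually_all.2 fun i =>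
      (tendsto_iff_norm_sub_tendsto_zero.1 (hV i)).eventually_lt_const hc2
    have e2 : ∀ᶠ n in atTop, ∀ i j, g i = g j → ‖B n i j‖ ≤ b :=
      eventually_all.2 fun i => eventually_all.2 fun j => by
        by_cases hij : g i = g j
        · exact ((hB i j hij).norm.eventually_lt_const (hbB i j)).mono fun n hn _ => hn.le
        · exact .of_forall fun n h => absurd h hij
    filter_upwards [e1, e2, eventually_sum_groupNorm_lt hg hT hadm hV hB hu hw hwq hwD
      (lt_add_one E)] with n h1 h2 h3
    refine (hadm n).bounds_of_mem_nehari hg hT (hneg n) (hu n).1 hc2 hb hS hTS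
      (fun i v => ?_) h2 h3.le
    have h4 := normSq_sub_le (V n i) (Vinf i) v
    have h5 := mul_le_mul_of_nonneg_right (h1 i).le (sq_nonneg ‖v‖)
    linarith [hcoer i v]
  have hest : ∀ (n : ℕ) (v : HProd Ω d), ∑ i, ‖v i‖ ^ 2 ≤ (E + 1) / (c / 2) →
      (∀ h, c / 2 / (S ^ 2 * b) ≤ ∑ i ∈ group d a h, ‖T (v i)‖ ^ 2) →
      interGroup a (B n) v ≤ m * (b * (S ^ 2 * ((E + 1) / (c / 2))) ^ 2) →
      Estimates a (B n) ((E + 1) / (c / 2)) (c / 2 / (S ^ 2 * b))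
        (m * (b * (S ^ 2 * ((E + 1) / (c / 2))) ^ 2) + 1) v := by
    intro n v h1 h2 h3
    refine ⟨(Finset.sum_le_sum fun i _ => integral_grad_sq_le (v i)).trans h1, fun h => ?_, ?_⟩
    · simp_rw [eLpNorm_four_toReal hT]
      exact h2 h
    · rw [(hadm n).sum_negCoupling hg]
      linarith
  have hultra : ∀ l : Ultrafilter ℕ, (l : Filter ℕ) ≤ atTop → _ := fun l hl =>
    exists_limit_of_ultrafilter hg hT hinf hadm hneg l
      (fun w v R h1 h2 => ⟨tendsto_toL2_of_weak hΩb h1 h2, hTc l w v R h1 h2⟩)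
      (fun i => (hV i).mono_left hl) (fun i j hij => (hB i j hij).mono_left hl)
      (fun i j hij C => hl (hinfty i j ((mem_K2_iff hg).2 hij) C)) hu hc hcoer
      (hl (hbounds.mono fun n h => h.1)) (by positivity) (hl (hbounds.mono fun n h => h.2.1))
      (hl (hbounds.mono fun n h => h.2.2))
  refine ⟨hbounds.mono fun n h => hest n _ h.1 h.2.1 h.2.2, ?_, ?_⟩
  · obtain ⟨v, hv, hmem, hmin, -⟩ := hultra (Ultrafilter.of atTop) (Ultrafilter.of_le _)
    -- The limit along a single ultrafilter is a cluster point of the sequence, which in a metric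
    -- space is the limit of a subsequence.
    have hcl : MapClusterPt v atTop u :=
      mapClusterPt_iff_ultrafilter.2 ⟨Ultrafilter.of atTop, Ultrafilter.of_le _, hv⟩
    obtain ⟨φ, hφ, hlim⟩ := hcl.tendsto_subseq
    have hbφ := hφ.tendsto_atTop.eventually hbounds
    have hi : ∀ i, Tendsto (fun k => u (φ k) i) atTop (𝓝 (v i)) := fun i =>
      ((PiLp.continuous_apply 2 (fun _ : Fin d => H01 Ω) i).tendsto v).comp hlim
    refine ⟨v, φ, hφ, hlim, hmem, hmin, fun n => hest n v ?_ (fun h => ?_) ?_⟩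
    · exact le_of_tendsto (tendsto_finsetSum _ fun i _ => (hi i).norm.pow 2)
        (hbφ.mono fun k h => h.1)
    · exact ge_of_tendsto (tendsto_finsetSum _ fun i _ =>
        ((T.continuous.tendsto _).comp (hi i)).norm.pow 2) (hbφ.mono fun k hk => hk.2.1 h)
    -- The limit is segregated, so its interaction energy is zero for every coupling matrix; this is
    -- why the third estimate holds for every n and not only for large n.
    · have h0 : interGroup a (B n) v = 0 := by
        rw [interGroup_eq hg]
        refine Finset.sum_eq_zero fun i _ => Finset.sum_eq_zero fun j _ => ?_
        split_ifs with hij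
        · rfl
        · exact negCoupling_eq_zero_of_segregated hT _
            (((mem_limitSet_iff hg hinf.1).1 hmem).2 i j hij)
      rw [h0]
      positivity
  -- The limit minimizer may depend on the ultrafilter, but the limit of the interaction energy is
  -- always zero, so the whole sequence converges.
  · refine (tendsto_iff_ultrafilter _ _ _).2 fun l hl => ?_
    obtain ⟨_, _, _, _, h⟩ := hultra l hl
    exact h
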